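/- Let $K\ge 2$, $p\in(0,1)$, $\varepsilon\in(0,1-p)$, and let $p_*^1,\dots,p_*^K$ be probability measures on $[0,1]^K$ such that under $p_*^i$ the $k$-th coordinate is $\mathrm{Bernoulli}(p+\varepsilon)$ if $k=i$ and $\mathrm{Bernoulli}(p)$ if $k\ne i$ (the dependence between coordinates is arbitrary). On a probability space let $p_*$ be uniformly distributed on $\{p_*^1,\dots,p_*^K\}$, and let $A_*\in\{1,\dots,K\}$ be a random action that almost surely maximizes the mean reward $a\mapsto\int r_a\,p_*(dr)$; put $R_*=\max_a\int r_a\,p_*(dr)$. Conditionally on $p_*$, the reward vectors $R_1,R_2,\dots$ are i.i.d. with law $p_*$ and independent of $A_*$. At each time $t\ge0$ an agent, having observed the history $H_t=(A_s,R_{s+1,A_s})_{0\le s<t}$, draws an action $A_t$ from a distribution that depends on $H_t$ only (so that, given $H_t$, the draw is independent of $p_*$, $A_*$ and the reward vectors). The agent is Thompson sampling: $\mathbb P_t(A_t=a)=\mathbb P_t(A_*=a)$ a.s. for all $t$ and $a$, where $\mathbb P_t=\mathbb P(\cdot\mid H_t)$ and $\mathbb E_t=\mathbb E[\cdot\mid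 H_t]$. Let $F(u)=\sum_{i:u_i>0}(u_i\log u_i-u_i)$ be the negentropy and $D_F(u,v)=F(u)-F(v)-\nabla_{u-v}F(v)$ its Bregman divergence, where $\nabla_{u-v}F(v)$ is the directional derivative of $F$ at $v$ in the direction $u-v$. Write $\pi(a)=\mathbb P_t(A_t=a)$, $\Delta_t=\sum_a\pi(a)\,\mathbb E_t[R_*-R_{t+1,a}]$, $g_t=\sum_a\pi(a)\,\mathbb E_t\big[D_F\big(\mathbb P_{t+1}(A_*\in\cdot),\mathbb P_t(A_*\in\cdot)\big)\mid A_t=a\big]$, $\Gamma_t=\Delta_t^2/g_t$ (the Shannon information ratio) and $q_t=\max_a\mathbb P_t(A_*=a)$. Then: 1. for every $t\ge1$, $\ \mathbb P\big(q_t>\tfrac12\big)\ge 1-\frac1\varepsilon\sqrt{\frac{8K}{t}}$; 2. for every $t\ge0$, almost surely $g_t>0$ and $\Gamma_t\le\dfrac{(1+q_t)^2}{2q_t^2}$; 3. for every $t\ge1$, $\ \mathbb P\big(\Gamma_t\le 8\big)\ge 1-\frac1\varepsilon\sqrt{\frac{8K}{t}}$; 4. for every $T\in\mathbb N$, $\ \mathrm{Regret}(T,\mathrm{TS}):=\mathbb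 E\Big[\sum_{t=0}^{T-1}(R_*-R_{t+1,A_t})\Big]\le 6\sqrt{2KT}$. -/

import Mathlib

open MeasureTheory ProbabilityTheory
open scoped unitInterval ENNReal

noncomputable section

/-- The set of probability measures on the cube `[0,1]^K` (the possible reward distributions). -/
abbrev RewardLaw (K : ℕ) : Type := ProbabilityMeasure (Fin K → I)

/-- The mean reward of action `a` under the reward distribution `P`. -/
def meanReward {K : ℕ} (P : RewardLaw K) (a : Fin K) : ℝ :=
  ∫ r, (r a : ℝ) ∂(P : Measure (Fin K → I))

/-- The history `H_t = (A_s, R_{s+1, A_s})_{0 ≤ s < t}`. -/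
def history {Ω : Type*} {K : ℕ} (A : ℕ → Ω → Fin K) (R : ℕ → Ω → Fin K → I) (t : ℕ) (ω : Ω) :
    Fin t → Fin K × I :=
  fun s => (A s ω, R (s + 1) ω (A s ω))

/-- The σ-algebra generated by the history `H_t`. -/
abbrev historySigma {Ω : Type*} {K : ℕ} (A : ℕ → Ω → Fin K) (R : ℕ → Ω → Fin K → I) (t : ℕ) :
    MeasurableSpace Ω :=
  MeasurableSpace.comap (history A R t) inferInstance

/-- A Bayesian `K`-armed bandit with rewards in `[0,1]`, together with an agent, on the
probability space `(Ω, μ)`. The reward vector `R t` is used for `t ≥ 1` only. -/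
structure BayesianBandit {Ω : Type*} [MeasurableSpace Ω] (K : ℕ) (μ : Measure Ω) where
  /-- the random reward distribution `p_*` -/
  pStar : Ω → RewardLaw K
  /-- the optimal action `A_*` -/
  AStar : Ω → Fin K
  /-- the reward vectors `R_1, R_2, …` -/
  R : ℕ → Ω → Fin K → I
  /-- the actions `A_0, A_1, …` of the agent -/
  A : ℕ → Ω → Fin K
  measurable_pStar : Measurable pStar
  measurable_AStar : Measurable AStar
  measurable_R : ∀ t, Measurable (R t)
  measurable_A : ∀ t, Measurable (A t)
  /-- `A_*` maximizes the mean reward under `p_*`. -/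
  optimal : ∀ᵐ ω ∂μ, ∀ a, meanReward (pStar ω) a ≤ meanReward (pStar ω) (AStar ω)
  /-- Conditioned on `p_*`, the reward vectors `R_1, R_2, …` are i.i.d. with distribution `p_*`. -/
  cond_iid : ∀ (S : Finset ℕ) (B : ℕ → Set (Fin K → I)), (∀ s, MeasurableSet (B s)) →
    μ⟦⋂ s ∈ S, R (s + 1) ⁻¹' B s | MeasurableSpace.comap pStar inferInstance⟧
      =ᵐ[μ] fun ω => ∏ s ∈ S, (pStar ω : Measure (Fin K → I)).real (B s)
  /-- Conditioned on `p_*`, the reward sequence is independent of `A_*`. -/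
  cond_indep_AStar : ∀ (a : Fin K) (S : Finset ℕ) (B : ℕ → Set (Fin K → I)),
    (∀ s, MeasurableSet (B s)) →
    μ⟦AStar ⁻¹' {a} ∩ ⋂ s ∈ S, R (s + 1) ⁻¹' B s | MeasurableSpace.comap pStar inferInstance⟧
      =ᵐ[μ] μ⟦AStar ⁻¹' {a} | MeasurableSpace.comap pStar inferInstance⟧ *
        μ⟦⋂ s ∈ S, R (s + 1) ⁻¹' B s | MeasurableSpace.comap pStar inferInstance⟧
  /-- The agent picks `A_t` from a distribution that is a function of the history `H_t` only:
  given `H_t`, the choice does not depend on `p_*`, `A_*` and the reward vectors. -/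
  policy : ∀ (t : ℕ) (a : Fin K),
    μ⟦A t ⁻¹' {a} | historySigma A R t ⊔ MeasurableSpace.comap pStar inferInstance ⊔
        MeasurableSpace.comap AStar inferInstance ⊔
        ⨆ s, MeasurableSpace.comap (R (s + 1)) inferInstance⟧
      =ᵐ[μ] μ⟦A t ⁻¹' {a} | historySigma A R t⟧

/-- The (generalized) Bregman divergence `D_F(u, v) = F(u) - F(v) - ∇_{u-v} F(v)`, where
`∇_{u-v} F(v)` is the one-sided directional derivative. -/
def bregman {K : ℕ} (F : (Fin K → ℝ) → ℝ) (u v : Fin K → ℝ) : ℝ :=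
  F u - F v - derivWithin (fun s : ℝ => F (v + s • (u - v))) (Set.Ici 0) 0

/-- The unnormalized negentropy potential. -/
def negentropy {K : ℕ} (u : Fin K → ℝ) : ℝ :=
  ∑ i, if 0 < u i then u i * Real.log (u i) - u i else 0

namespace BayesianBandit

variable {Ω : Type*} [MeasurableSpace Ω] {K : ℕ} {μ : Measure Ω}

/-- The σ-algebra generated by `H_t`. -/
abbrev hist (B : BayesianBandit K μ) (t : ℕ) : MeasurableSpace Ω := historySigma B.A B.R t

/-- The optimal mean reward `R_*`. -/
def RStar (B : BayesianBandit K μ) (ω : Ω) : ℝ := ⨆ a, meanReward (B.pStar ω) a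

/-- The Bayesian regret after `T` steps. -/
def regret (B : BayesianBandit K μ) (T : ℕ) : ℝ :=
  ∫ ω, ∑ t ∈ Finset.range T, (B.RStar ω - (B.R (t + 1) ω (B.A t ω) : ℝ)) ∂μ

/-- The posterior distribution `ℙ_t(A_* = a)` of the optimal action. -/
def posterior (B : BayesianBandit K μ) (t : ℕ) (ω : Ω) (a : Fin K) : ℝ :=
  (μ⟦B.AStar ⁻¹' {a} | B.hist t⟧) ω

/-- The probability `π(a) = ℙ_t(A_t = a)` with which the agent selects `a` at time `t`. -/
def actionProb (B : BayesianBandit K μ) (t : ℕ) (ω : Ω) (a : Fin K) : ℝ :=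
  (μ⟦B.A t ⁻¹' {a} | B.hist t⟧) ω

/-- The agent is Thompson sampling (probability matching). -/
def IsThompsonSampling (B : BayesianBandit K μ) : Prop :=
  ∀ (t : ℕ) (a : Fin K), ∀ᵐ ω ∂μ, B.actionProb t ω a = B.posterior t ω a

/-- `Δ_t(a) = 𝔼_t[R_* - R_{t+1,a}]`. -/
def expRegret (B : BayesianBandit K μ) (t : ℕ) (a : Fin K) : Ω → ℝ :=
  μ[fun ω => B.RStar ω - (B.R (t + 1) ω a : ℝ) | B.hist t]

/-- `g_t^F(a) = 𝔼_t[D_F(ℙ_{t+1}(A_* ∈ ·), ℙ_t(A_* ∈ ·)) | A_t = a]`, where the conditional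
expectation of `X` given the history and the event `A_t = a` is
`𝔼_t[X 1{A_t = a}] / ℙ_t(A_t = a)`. -/
def infoGain (B : BayesianBandit K μ) (F : (Fin K → ℝ) → ℝ) (t : ℕ) (a : Fin K) (ω : Ω) : ℝ :=
  (μ[(B.A t ⁻¹' {a}).indicator
      (fun ω' => bregman F (B.posterior (t + 1) ω') (B.posterior t ω')) | B.hist t]) ω /
    B.actionProb t ω a

/-- `Δ_t(π) = ∑_a π(a) Δ_t(a)` for the policy `π` of the agent. -/
def policyRegret (B : BayesianBandit K μ) (t : ℕ) (ω : Ω) : ℝ :=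
  ∑ a, B.actionProb t ω a * B.expRegret t a ω

/-- `g_t^F(π) = ∑_a π(a) g_t^F(a)` for the policy `π` of the agent. -/
def policyInfoGain (B : BayesianBandit K μ) (F : (Fin K → ℝ) → ℝ) (t : ℕ) (ω : Ω) : ℝ :=
  ∑ a, B.actionProb t ω a * B.infoGain F t a ω

/-- The information ratio `Γ_t^F(π) = Δ_t(π)² / g_t^F(π)`. -/
def infoRatio (B : BayesianBandit K μ) (F : (Fin K → ℝ) → ℝ) (t : ℕ) (ω : Ω) : ℝ :=
  (B.policyRegret t ω) ^ 2 / B.policyInfoGain F t ω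

/-- `q_t = max_a ℙ_t(A_* = a)`. -/
def maxPosterior (B : BayesianBandit K μ) (t : ℕ) (ω : Ω) : ℝ := ⨆ a, B.posterior t ω a

end BayesianBandit

/-- The reward distributions `p_*^1, …, p_*^K` of the example: under `p_*^i` the marginal of arm
`k` is Bernoulli with mean `p + ε` if `k = i` and `p` if `k ≠ i`. The dependence between the arms
is left arbitrary. -/
def HasHardMarginals {K : ℕ} (p ε : ℝ) (P : Fin K → RewardLaw K) : Prop :=
  ∀ i k : Fin K, ∃ q : I, (q : ℝ) = (if i = k then p + ε else p) ∧
    (P i : Measure (Fin K → I)).map (fun r => r k) = bernoulliMeasure 1 0 q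

/-- The prior `P_*`: probability `1/K` on each of `p_*^1, …, p_*^K`. -/
def uniformPrior {K : ℕ} (P : Fin K → RewardLaw K) : Measure (RewardLaw K) :=
  ∑ i, (K : ℝ≥0∞)⁻¹ • Measure.dirac (P i)

end

/-! Since `ε > 0`, environment `i` has `i` as its unique best arm, so `A_*` almost surely determines
the environment. The rewards are almost surely 0 or 1, so `H_t` takes finitely many values and
conditioning on it is averaging over atoms. All data then become functions of the belief `α`, the
posterior of `A_*`: it evolves by Bayes' rule, the predictive mean of arm `a` is `p + ε α_a`, and
the regret of Thompson sampling is `ε (1 - ∑ α_i²)`. All likelihoods are positive, so `α` stays in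
the interior of the simplex.

Information ratio: Pinsker bounds the information gain of arm `a` below by `2 ε² α_a (1 - α_a)`.
Keeping only the most likely arm in the gain and in `∑ α_i²` gives `Γ ≤ (1 + q)² (1 - q) / (2 q²)`
(`belief_infoRatio_le`).

Regret: the Shannon ratio may be large while `q` is small, so the regret is controlled by the
potential `2 ∑ √α_i` instead. A Hellinger bound and Cauchy-Schwarz show that the squared regret of a
step is at most `√K` times the expected drop of the potential (`sq_regret_le_sqrt`). The potential
starts at most at `2 √K`; telescoping makes the squares of the expected step regrets sum to at most
`2K`, whence regret at most `√(2KT)`, which is stronger than the claim.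

Concentration: `∑ α_i²` is a submartingale, so the expected step regret decreases and is at most
`√(2K/t)` at time `t`. If `q ≤ 1/2` the step regret is at least `ε/2`, so Markov's inequality gives
claim 1. Claim 3 combines claims 1 and 2. -/

noncomputable section

/-- The success probability of arm `a` in the environment in which arm `i` is optimal. -/
def armMean {K : ℕ} (p ε : ℝ) (i a : Fin K) : ℝ := if i = a then p + ε else p

/-- The probability of the reward `y ∈ {0, 1}` for arm `a` in the environment in which arm `i` is
optimal. -/
def armLik {K : ℕ} (p ε : ℝ) (i a : Fin K) (y : I) : ℝ :=
  if y = 1 then armMean p ε i a else 1 - armMean p ε i a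

/-- The predictive probability of the reward `y` for arm `a` under the belief `α`. -/
def mixLik {K : ℕ} (p ε : ℝ) (α : Fin K → ℝ) (a : Fin K) (y : I) : ℝ :=
  ∑ i, α i * armLik p ε i a y

/-- The Bayesian update of the belief `α` after observing the reward `y` of arm `a`. -/
def bayesUpdate {K : ℕ} (p ε : ℝ) (α : Fin K → ℝ) (a : Fin K) (y : I) (i : Fin K) : ℝ :=
  α i * armLik p ε i a y / mixLik p ε α a y

/-- The expectation of `f y` for the predictive distribution of arm `a` under the belief `α`. -/
def predict {K : ℕ} (p ε : ℝ) (α : Fin K → ℝ) (a : Fin K) (f : I → ℝ) : ℝ :=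
  ∑ y ∈ ({0, 1} : Finset I), mixLik p ε α a y * f y

/-! ### Inequalities between Bernoulli laws, and the divergence of the negentropy. -/

section Scalar

/-- The right side is `(√x - √y)² + (√(1-x) - √(1-y))²`. Writing `2 (x - y)` as a sum of two
differences of squares and applying Cauchy-Schwarz leaves a second factor of at most 4. -/
lemma sq_sub_le_hellinger {x y : ℝ} (hx : x ∈ Set.Icc (0 : ℝ) 1) (hy : y ∈ Set.Icc (0 : ℝ) 1) :
    (x - y) ^ 2 ≤ 2 - 2 * (√x * √y) - 2 * (√(1 - x) * √(1 - y)) := by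
  have ha := Real.sq_sqrt hx.1
  have hb := Real.sq_sqrt hy.1
  have hc := Real.sq_sqrt (sub_nonneg.2 hx.2)
  have hd := Real.sq_sqrt (sub_nonneg.2 hy.2)
  set a := √x
  set b := √y
  set c := √(1 - x)
  set d := √(1 - y)
  have h1 : 2 * (x - y) = (a - b) * (a + b) + (d - c) * (d + c) := by
    linear_combination hb - ha + hc - hd
  have h2 : (2 * (x - y)) ^ 2 ≤ ((a - b) ^ 2 + (d - c) ^ 2) * ((a + b) ^ 2 + (d + c) ^ 2) := by
    rw [h1]
    nlinarith [sq_nonneg ((a - b) * (d + c) - (d - c) * (a + b))]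
  have h3 : (a + b) ^ 2 + (d + c) ^ 2 ≤ 4 := by
    nlinarith [sq_nonneg (a - b), sq_nonneg (d - c)]
  have h4 : (a - b) ^ 2 + (d - c) ^ 2 = 2 - 2 * (a * b) - 2 * (c * d) := by
    linear_combination ha + hb + hc + hd
  have h5 : 0 ≤ (a - b) ^ 2 + (d - c) ^ 2 := by positivity
  nlinarith [mul_le_mul_of_nonneg_left h3 h5]

/-- **Pinsker's inequality** for Bernoulli distributions. -/
lemma bernoulli_pinsker {x y : ℝ} (hx : x ∈ Set.Ioo (0 : ℝ) 1) (hy : y ∈ Set.Ioo (0 : ℝ) 1) :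
    2 * (x - y) ^ 2 ≤
      x * (Real.log x - Real.log y) + (1 - x) * (Real.log (1 - x) - Real.log (1 - y)) := by
  set f : ℝ → ℝ := fun z => x * (Real.log x - Real.log z) +
    (1 - x) * (Real.log (1 - x) - Real.log (1 - z)) - 2 * (x - z) ^ 2 with hf
  -- As `z (1 - z) ≤ 1/4`, the derivative has the sign of `z - x`; so `f` is minimal at `z = x`,
  -- where it vanishes.
  have hder : ∀ z ∈ Set.Ioo (0 : ℝ) 1,
      HasDerivAt f ((z - x) * (1 / (z * (1 - z)) - 4)) z := by
    intro z hz
    have hz0 : z ≠ 0 := hz.1.ne'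
    have hz1 : 1 - z ≠ 0 := (sub_pos.2 hz.2).ne'
    have h1 := ((Real.hasDerivAt_log hz0).const_sub (Real.log x)).const_mul x
    have h2 := ((((hasDerivAt_id z).const_sub 1).log hz1).const_sub
      (Real.log (1 - x))).const_mul (1 - x)
    have h3 := (((hasDerivAt_id z).const_sub x).pow 2).const_mul 2
    refine ((h1.fun_add h2).fun_sub h3).congr_deriv ?_
    simp only [id]
    field_simp
    ring
  have hquad : ∀ z ∈ Set.Ioo (0 : ℝ) 1, 0 ≤ 1 / (z * (1 - z)) - 4 := by
    intro z hz
    have : 0 < z * (1 - z) := mul_pos hz.1 (sub_pos.2 hz.2)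
    rw [sub_nonneg, le_div_iff₀ this]
    nlinarith [sq_nonneg (2 * z - 1)]
  have hfx : f x = 0 := by simp [hf]
  have key : 0 ≤ f y := by
    rw [← hfx]
    rcases le_total x y with h | h
    · have hsub : Set.Icc x y ⊆ Set.Ioo 0 1 := fun z hz =>
        ⟨hx.1.trans_le hz.1, hz.2.trans_lt hy.2⟩
      refine monotoneOn_of_deriv_nonneg (convex_Icc x y)
        (fun z hz => (hder z (hsub hz)).continuousAt.continuousWithinAt)
        (fun z hz => (hder z (hsub (interior_subset hz))).differentiableAt.differentiableWithinAt)
        (fun z hz => ?_) (Set.left_mem_Icc.2 h) (Set.right_mem_Icc.2 h) h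
      have hz' := interior_subset hz
      rw [(hder z (hsub hz')).deriv]
      exact mul_nonneg (sub_nonneg.2 hz'.1) (hquad z (hsub hz'))
    · have hsub : Set.Icc y x ⊆ Set.Ioo 0 1 := fun z hz =>
        ⟨hy.1.trans_le hz.1, hz.2.trans_lt hx.2⟩
      refine antitoneOn_of_deriv_nonpos (convex_Icc y x)
        (fun z hz => (hder z (hsub hz)).continuousAt.continuousWithinAt)
        (fun z hz => (hder z (hsub (interior_subset hz))).differentiableAt.differentiableWithinAt)
        (fun z hz => ?_) (Set.left_mem_Icc.2 h) (Set.right_mem_Icc.2 h) h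
      have hz' := interior_subset hz
      rw [(hder z (hsub hz')).deriv]
      exact mul_nonpos_of_nonpos_of_nonneg (sub_nonpos.2 hz'.2) (hquad z (hsub hz'))
  simp only [hf] at key
  linarith

end Scalar

/-- At an interior point `v` the segment towards `u` stays in the positive orthant for small `s` of
either sign, so the one-sided derivative is an ordinary one. -/
lemma bregman_negentropy {K : ℕ} {u v : Fin K → ℝ} (hu : ∀ i, 0 < u i) (hv : ∀ i, 0 < v i) :
    bregman negentropy u v = ∑ i, (u i * (Real.log (u i) - Real.log (v i)) - u i + v i) := by
  have hpos : ∀ w : Fin K → ℝ, (∀ i, 0 < w i) →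
      negentropy w = ∑ i, (w i * Real.log (w i) - w i) := fun w hw => by
    simp [negentropy, hw]
  have hev : (fun s : ℝ => negentropy (v + s • (u - v))) =ᶠ[nhds 0]
      fun s => ∑ i, ((v i + s * (u i - v i)) * Real.log (v i + s * (u i - v i)) -
        (v i + s * (u i - v i))) := by
    have : ∀ i, ∀ᶠ s : ℝ in nhds 0, 0 < v i + s * (u i - v i) := fun i => by
      have hc : ContinuousAt (fun s : ℝ => v i + s * (u i - v i)) 0 := by fun_prop
      exact hc.eventually (lt_mem_nhds (by simpa using hv i))
    filter_upwards [Filter.eventually_all.2 this] with s hs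
    rw [hpos _ (by simpa using hs)]
    simp
  have hder : HasDerivAt (fun s : ℝ => ∑ i, ((v i + s * (u i - v i)) *
      Real.log (v i + s * (u i - v i)) - (v i + s * (u i - v i))))
      (∑ i, (u i - v i) * Real.log (v i)) 0 := by
    refine HasDerivAt.fun_sum fun i _ => ?_
    have h1 : HasDerivAt (fun s : ℝ => v i + s * (u i - v i)) (u i - v i) 0 := by
      simpa using ((hasDerivAt_id (0 : ℝ)).mul_const (u i - v i)).const_add (v i)
    have h2 := h1.log (by simpa using (hv i).ne')
    convert (h1.fun_mul h2).fun_sub h1 using 1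
    have := (hv i).ne'
    simp only [zero_mul, add_zero]
    field_simp
    ring
  rw [bregman, ((hder.congr_of_eventuallyEq hev).hasDerivWithinAt).derivWithin
    (uniqueDiffWithinAt_Ici 0), hpos u hu, hpos v hv, ← Finset.sum_sub_distrib,
    ← Finset.sum_sub_distrib]
  exact Finset.sum_congr rfl fun i _ => by ring

/-! ### One step of Thompson sampling as a deterministic computation on beliefs. -/

section Belief

variable {K : ℕ} {p ε : ℝ} {α : Fin K → ℝ}

lemma armMean_mem (hp : p ∈ Set.Ioo (0 : ℝ) 1) (hε : ε ∈ Set.Ioo 0 (1 - p)) (i a : Fin K) :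
    armMean p ε i a ∈ Set.Ioo (0 : ℝ) 1 := by
  unfold armMean
  split_ifs
  · exact ⟨add_pos hp.1 hε.1, by linarith [hε.2]⟩
  · exact hp

lemma armLik_pos (hp : p ∈ Set.Ioo (0 : ℝ) 1) (hε : ε ∈ Set.Ioo 0 (1 - p)) (i a : Fin K) (y : I) :
    0 < armLik p ε i a y := by
  have := armMean_mem hp hε i a
  unfold armLik
  split_ifs
  · exact this.1
  · exact sub_pos.2 this.2

@[simp] lemma armLik_one (i a : Fin K) : armLik p ε i a 1 = armMean p ε i a := if_pos rfl

@[simp] lemma armLik_zero (i a : Fin K) : armLik p ε i a 0 = 1 - armMean p ε i a :=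
  if_neg zero_ne_one

lemma sum_mul_armMean (hsum : ∑ i, α i = 1) (a : Fin K) :
    ∑ i, α i * armMean p ε i a = p + ε * α a := by
  have : ∀ i, α i * armMean p ε i a = p * α i + ε * (if i = a then α i else 0) := fun i => by
    unfold armMean
    split_ifs <;> ring
  simp only [this, Finset.sum_add_distrib, ← Finset.mul_sum, hsum]
  simp

lemma mixLik_one (hsum : ∑ i, α i = 1) (a : Fin K) : mixLik p ε α a 1 = p + ε * α a := by
  simp [mixLik, sum_mul_armMean hsum]

lemma mixLik_zero (hsum : ∑ i, α i = 1) (a : Fin K) : mixLik p ε α a 0 = 1 - (p + ε * α a) := by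
  simp [mixLik, mul_sub, Finset.sum_sub_distrib, hsum, sum_mul_armMean hsum]

lemma mixLik_pos (hp : p ∈ Set.Ioo (0 : ℝ) 1) (hε : ε ∈ Set.Ioo 0 (1 - p)) (hα : ∀ i, 0 < α i)
    (a : Fin K) (y : I) : 0 < mixLik p ε α a y :=
  Finset.sum_pos (fun i _ => mul_pos (hα i) (armLik_pos hp hε i a y)) ⟨a, Finset.mem_univ a⟩

lemma bayesUpdate_pos (hp : p ∈ Set.Ioo (0 : ℝ) 1) (hε : ε ∈ Set.Ioo 0 (1 - p))
    (hα : ∀ i, 0 < α i) (a : Fin K) (y : I) (i : Fin K) : 0 < bayesUpdate p ε α a y i :=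
  div_pos (mul_pos (hα i) (armLik_pos hp hε i a y)) (mixLik_pos hp hε hα a y)

lemma predict_eq (f : I → ℝ) (a : Fin K) :
    predict p ε α a f = mixLik p ε α a 0 * f 0 + mixLik p ε α a 1 * f 1 := by
  rw [predict, Finset.sum_pair zero_ne_one]

lemma mix_mem (hp : p ∈ Set.Ioo (0 : ℝ) 1) (hε : ε ∈ Set.Ioo 0 (1 - p)) (hα : ∀ i, 0 < α i)
    (hsum : ∑ i, α i = 1) (a : Fin K) : p + ε * α a ∈ Set.Ioo (0 : ℝ) 1 := by
  have h1 := mixLik_pos hp hε hα a 1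
  have h0 := mixLik_pos hp hε hα a 0
  rw [mixLik_one hsum] at h1
  rw [mixLik_zero hsum] at h0
  exact ⟨h1, by linarith⟩

lemma sum_sq_armMean_sub (hsum : ∑ i, α i = 1) (a : Fin K) :
    ∑ i, α i * (armMean p ε i a - (p + ε * α a)) ^ 2 = ε ^ 2 * (α a * (1 - α a)) := by
  have : ∀ i, α i * (armMean p ε i a - (p + ε * α a)) ^ 2 =
      ε ^ 2 * α a ^ 2 * α i + ε ^ 2 * (1 - 2 * α a) * (if i = a then α i else 0) := fun i => by
    unfold armMean
    split_ifs <;> ring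
  simp only [this, Finset.sum_add_distrib, ← Finset.mul_sum, hsum]
  simp
  ring

/-- The expected Shannon information gain of playing arm `a` is at least twice the variance of
its mean reward. -/
lemma le_predict_bregman (hp : p ∈ Set.Ioo (0 : ℝ) 1) (hε : ε ∈ Set.Ioo 0 (1 - p))
    (hα : ∀ i, 0 < α i) (hsum : ∑ i, α i = 1) (a : Fin K) :
    2 * (ε ^ 2 * (α a * (1 - α a))) ≤
      predict p ε α a fun y => bregman negentropy (bayesUpdate p ε α a y) α := by
  -- Symmetry of mutual information: the divergence of posterior from prior averaged over `y`
  -- becomes the divergence of arm law from predictive law averaged over `i`. The linear terms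
  -- cancel once summed over `y`.
  have hterm : ∀ y, mixLik p ε α a y * bregman negentropy (bayesUpdate p ε α a y) α =
      ∑ i, α i * (armLik p ε i a y * (Real.log (armLik p ε i a y) -
        Real.log (mixLik p ε α a y)) - armLik p ε i a y + mixLik p ε α a y) := fun y => by
    have hm := mixLik_pos hp hε hα a y
    rw [bregman_negentropy (bayesUpdate_pos hp hε hα a y) hα, Finset.mul_sum]
    refine Finset.sum_congr rfl fun i _ => ?_
    have hl := armLik_pos hp hε i a y
    have hαi := hα i
    rw [bayesUpdate, Real.log_div (by positivity) hm.ne', Real.log_mul hαi.ne' hl.ne']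
    field_simp
    ring
  rw [predict_eq, hterm, hterm, ← Finset.sum_add_distrib, ← sum_sq_armMean_sub hsum (p := p),
    Finset.mul_sum]
  refine Finset.sum_le_sum fun i _ => ?_
  have := mul_le_mul_of_nonneg_left
    (bernoulli_pinsker (armMean_mem hp hε i a) (mix_mem hp hε hα hsum a)) (hα i).le
  simp only [armLik_one, armLik_zero, mixLik_one hsum, mixLik_zero hsum]
  linarith

/-- The expected decrease of `2 ∑ √αᵢ` caused by playing arm `a`. -/
lemma le_sub_predict_sqrt (hp : p ∈ Set.Ioo (0 : ℝ) 1) (hε : ε ∈ Set.Ioo 0 (1 - p))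
    (hα : ∀ i, 0 < α i) (hsum : ∑ i, α i = 1) (a : Fin K) :
    √(α a) * (ε * (1 - α a)) ^ 2 ≤
      (∑ i, 2 * √(α i)) - predict p ε α a fun y => ∑ i, 2 * √(bayesUpdate p ε α a y i) := by
  have hterm : ∀ y, mixLik p ε α a y * ∑ i, 2 * √(bayesUpdate p ε α a y i) =
      ∑ i, √(α i) * (2 * (√(armLik p ε i a y) * √(mixLik p ε α a y))) := fun y => by
    have hm := mixLik_pos hp hε hα a y
    rw [Finset.mul_sum]
    refine Finset.sum_congr rfl fun i _ => ?_
    have hl := armLik_pos hp hε i a y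
    rw [bayesUpdate, Real.sqrt_div (mul_pos (hα i) hl).le, Real.sqrt_mul (hα i).le]
    have h2 := Real.sqrt_pos.2 hm
    nth_rw 1 [← Real.mul_self_sqrt hm.le]
    field_simp
  rw [predict_eq, hterm, hterm, ← Finset.sum_add_distrib, ← Finset.sum_sub_distrib]
  have hle : ∀ i, √(α i) * (armMean p ε i a - (p + ε * α a)) ^ 2 ≤ 2 * √(α i) -
      (√(α i) * (2 * (√(armLik p ε i a 0) * √(mixLik p ε α a 0))) +
        √(α i) * (2 * (√(armLik p ε i a 1) * √(mixLik p ε α a 1)))) := fun i => by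
    have := mul_le_mul_of_nonneg_left (sq_sub_le_hellinger
      (Set.Ioo_subset_Icc_self (armMean_mem hp hε i a))
      (Set.Ioo_subset_Icc_self (mix_mem hp hε hα hsum a))) (Real.sqrt_nonneg (α i))
    simp only [armLik_one, armLik_zero, mixLik_one hsum, mixLik_zero hsum]
    linarith
  refine le_trans ?_ (Finset.sum_le_sum fun i _ => hle i)
  -- Only the term `i = a` is kept; there the mean of the arm exceeds the predictive mean by `ε (1 -
  -- α a)`.
  refine le_trans (le_of_eq ?_) (Finset.single_le_sum (f := fun i =>
    √(α i) * (armMean p ε i a - (p + ε * α a)) ^ 2) (fun i _ => by positivity)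
    (Finset.mem_univ a))
  simp only [armMean, if_true]
  ring

lemma sum_sqrt_le (hα : ∀ i, 0 < α i) (hsum : ∑ i, α i = 1) : ∑ i, √(α i) ≤ √K := by
  refine Real.le_sqrt_of_sq_le ?_
  have := sq_sum_le_card_mul_sum_sq (s := Finset.univ) (f := fun i => √(α i))
  simpa [Real.sq_sqrt (hα _).le, hsum] using this

lemma sum_mul_one_sub (hsum : ∑ i, α i = 1) : ∑ i, α i * (1 - α i) = 1 - ∑ i, α i ^ 2 := by
  simp [mul_sub, hsum, sq]

lemma sq_regret_le_sqrt (hp : p ∈ Set.Ioo (0 : ℝ) 1) (hε : ε ∈ Set.Ioo 0 (1 - p))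
    (hα : ∀ i, 0 < α i) (hsum : ∑ i, α i = 1) :
    (ε * (1 - ∑ i, α i ^ 2)) ^ 2 ≤ √K * ((∑ i, 2 * √(α i)) -
      ∑ a, α a * predict p ε α a fun y => ∑ i, 2 * √(bayesUpdate p ε α a y i)) := by
  have h1 : ∑ a, α a * (√(α a) * (ε * (1 - α a)) ^ 2) ≤ (∑ i, 2 * √(α i)) -
      ∑ a, α a * predict p ε α a fun y => ∑ i, 2 * √(bayesUpdate p ε α a y i) := by
    calc _ ≤ ∑ a, α a * ((∑ i, 2 * √(α i)) -
          predict p ε α a fun y => ∑ i, 2 * √(bayesUpdate p ε α a y i)) :=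
        Finset.sum_le_sum fun a _ => mul_le_mul_of_nonneg_left
          (le_sub_predict_sqrt hp hε hα hsum a) (hα a).le
      _ = _ := by
        simp only [mul_sub, Finset.sum_sub_distrib, ← Finset.sum_mul, hsum, one_mul]
  -- Cauchy-Schwarz with the weights `√(α i)`: each summand squared is exactly the product of the
  -- two terms on the right.
  have h2 : (∑ i, ε * (α i * (1 - α i))) ^ 2 ≤
      (∑ i, √(α i)) * ∑ a, α a * (√(α a) * (ε * (1 - α a)) ^ 2) :=
    Finset.sum_sq_le_sum_mul_sum_of_sq_le_mul _ (fun i _ => Real.sqrt_nonneg _)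
      (fun i _ => mul_nonneg (hα i).le (by positivity)) fun i _ => le_of_eq <| by
        have := Real.mul_self_sqrt (hα i).le
        linear_combination -(α i * ε ^ 2 * (1 - α i) ^ 2) * this
  rw [← Finset.mul_sum, sum_mul_one_sub hsum] at h2
  have h3 : 0 ≤ ∑ a, α a * (√(α a) * (ε * (1 - α a)) ^ 2) :=
    Finset.sum_nonneg fun i _ => mul_nonneg (hα i).le (by positivity)
  exact h2.trans (mul_le_mul (sum_sqrt_le hα hsum) h1 h3 (Real.sqrt_nonneg _))

/-- Jensen's inequality for the martingale of posteriors, valid for each arm separately. It follows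
from the tangent bound `β² ≥ 2 α β - α²`, weighted by `mixLik` and summed over the two rewards. -/
lemma sum_sq_le_predict (hp : p ∈ Set.Ioo (0 : ℝ) 1) (hε : ε ∈ Set.Ioo 0 (1 - p))
    (hα : ∀ i, 0 < α i) (hsum : ∑ i, α i = 1) :
    ∑ i, α i ^ 2 ≤
      ∑ a, α a * predict p ε α a fun y => ∑ i, bayesUpdate p ε α a y i ^ 2 := by
  have hle : ∀ a, ∑ i, α i ^ 2 ≤ predict p ε α a fun y => ∑ i, bayesUpdate p ε α a y i ^ 2 := by
    intro a
    have hterm : ∀ y, ∑ i, (2 * α i ^ 2 * armLik p ε i a y - α i ^ 2 * mixLik p ε α a y) ≤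
        mixLik p ε α a y * ∑ i, bayesUpdate p ε α a y i ^ 2 := fun y => by
      have hm := mixLik_pos hp hε hα a y
      rw [Finset.mul_sum]
      refine Finset.sum_le_sum fun i _ => ?_
      have h : α i * armLik p ε i a y = mixLik p ε α a y * bayesUpdate p ε α a y i := by
        rw [bayesUpdate]
        field_simp
      have h' : 2 * α i ^ 2 * armLik p ε i a y =
          2 * α i * (mixLik p ε α a y * bayesUpdate p ε α a y i) := by
        rw [← h]
        ring
      rw [h']
      nlinarith [mul_nonneg hm.le (sq_nonneg (α i - bayesUpdate p ε α a y i))]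
    rw [predict_eq]
    refine le_trans (le_of_eq ?_) (add_le_add (hterm 0) (hterm 1))
    rw [← Finset.sum_add_distrib, mixLik_zero hsum, mixLik_one hsum]
    refine Finset.sum_congr rfl fun i _ => ?_
    simp only [armLik_one, armLik_zero]
    ring
  calc ∑ i, α i ^ 2 = ∑ a, α a * ∑ i, α i ^ 2 := by rw [← Finset.sum_mul, hsum, one_mul]
    _ ≤ _ := Finset.sum_le_sum fun a _ => mul_le_mul_of_nonneg_left (hle a) (hα a).le

/-- The expected Shannon information gain of Thompson sampling under the belief `α`. -/
def beliefGain (p ε : ℝ) (α : Fin K → ℝ) : ℝ :=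
  ∑ a, α a * predict p ε α a fun y => bregman negentropy (bayesUpdate p ε α a y) α

lemma le_beliefGain (hp : p ∈ Set.Ioo (0 : ℝ) 1) (hε : ε ∈ Set.Ioo 0 (1 - p))
    (hα : ∀ i, 0 < α i) (hsum : ∑ i, α i = 1) :
    2 * ε ^ 2 * ∑ a, α a ^ 2 * (1 - α a) ≤ beliefGain p ε α := by
  rw [Finset.mul_sum]
  refine Finset.sum_le_sum fun a _ => ?_
  have := mul_le_mul_of_nonneg_left (le_predict_bregman hp hε hα hsum a) (hα a).le
  linarith

lemma belief_lt_one (hK : 2 ≤ K) (hα : ∀ i, 0 < α i) (hsum : ∑ i, α i = 1) (a : Fin K) :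
    α a < 1 := by
  have : Nontrivial (Fin K) := Fin.nontrivial_iff_two_le.2 hK
  obtain ⟨b, hb⟩ := exists_ne a
  rw [← hsum]
  exact Finset.single_lt_sum hb (Finset.mem_univ a) (Finset.mem_univ b) (hα b)
    fun i _ _ => (hα i).le

/-- With `q` the largest belief, the regret is at most `ε (1 - q²)` and the gain at least `2 ε² q²
(1 - q)`. Two arms are needed for `q < 1`, hence for a positive gain; the final step drops a factor
`1 - q`. -/
lemma belief_infoRatio_le (hK : 2 ≤ K) (hp : p ∈ Set.Ioo (0 : ℝ) 1) (hε : ε ∈ Set.Ioo 0 (1 - p))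
    (hα : ∀ i, 0 < α i) (hsum : ∑ i, α i = 1) :
    0 < beliefGain p ε α ∧ (ε * (1 - ∑ i, α i ^ 2)) ^ 2 / beliefGain p ε α ≤
      (1 + ⨆ a, α a) ^ 2 / (2 * (⨆ a, α a) ^ 2) := by
  have : Nonempty (Fin K) := ⟨⟨0, by omega⟩⟩
  obtain ⟨b, hb⟩ := exists_eq_ciSup_of_finite (f := α)
  rw [← hb]
  have hlt := belief_lt_one hK hα hsum
  have hε0 : 0 < ε := hε.1
  have hq : 0 < α b := hα b
  have h1q : 0 < 1 - α b := sub_pos.2 (hlt b)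
  have hle1 : α b ^ 2 * (1 - α b) ≤ ∑ a, α a ^ 2 * (1 - α a) :=
    Finset.single_le_sum (f := fun a => α a ^ 2 * (1 - α a))
      (fun i _ => mul_nonneg (sq_nonneg _) (sub_pos.2 (hlt i)).le) (Finset.mem_univ b)
  have hlow : 2 * ε ^ 2 * (α b ^ 2 * (1 - α b)) ≤ beliefGain p ε α :=
    (mul_le_mul_of_nonneg_left hle1 (by positivity)).trans (le_beliefGain hp hε hα hsum)
  have hpos : 0 < 2 * ε ^ 2 * (α b ^ 2 * (1 - α b)) := by positivity
  refine ⟨hpos.trans_le hlow, ?_⟩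
  have hsq : α b ^ 2 ≤ ∑ i, α i ^ 2 :=
    Finset.single_le_sum (f := fun a => α a ^ 2) (fun i _ => sq_nonneg _) (Finset.mem_univ b)
  have hsq1 : ∑ i, α i ^ 2 ≤ 1 := by
    rw [← hsum]
    exact Finset.sum_le_sum fun i _ => by nlinarith [hα i, hlt i]
  calc (ε * (1 - ∑ i, α i ^ 2)) ^ 2 / beliefGain p ε α
      ≤ (ε * (1 - α b ^ 2)) ^ 2 / (2 * ε ^ 2 * (α b ^ 2 * (1 - α b))) := by
        refine div_le_div₀ (sq_nonneg _) ?_ hpos hlow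
        have : 0 ≤ 1 - ∑ i, α i ^ 2 := by linarith
        gcongr
    _ = (1 + α b) ^ 2 * (1 - α b) / (2 * α b ^ 2) := by
        field_simp
        ring
    _ ≤ (1 + α b) ^ 2 / (2 * α b ^ 2) := by
        gcongr
        exact mul_le_of_le_one_right (sq_nonneg _) (by linarith)

end Belief

/-! ### Conditional expectation given a variable with finitely many values. -/

section Atoms

variable {Ω X : Type*} [MeasurableSpace Ω] [MeasurableSpace X] [MeasurableSingletonClass X]
  {μ : Measure Ω} {H : Ω → X}

/-- On an atom of a σ-algebra `σ(H)` the conditional expectation is an average. -/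
lemma condExp_comap_mul_atom [IsFiniteMeasure μ] (hH : Measurable H) {f : Ω → ℝ}
    (hf : Integrable f μ) (ω : Ω) :
    (μ[f | MeasurableSpace.comap H inferInstance]) ω * μ.real (H ⁻¹' {H ω}) =
      ∫ x in H ⁻¹' {H ω}, f x ∂μ := by
  have hs : MeasurableSet[MeasurableSpace.comap H inferInstance] (H ⁻¹' {H ω}) :=
    ⟨{H ω}, measurableSet_singleton _, rfl⟩
  have hfac := (stronglyMeasurable_condExp (μ := μ) (f := f)
    (m := MeasurableSpace.comap H inferInstance)).factorsThrough
  rw [← setIntegral_condExp hH.comap_le hf hs,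
    setIntegral_congr_fun (hH.comap_le _ hs) (g := fun _ =>
      (μ[f | MeasurableSpace.comap H inferInstance]) ω) (fun x hx => hfac hx),
    setIntegral_const, smul_eq_mul, mul_comm]

lemma condExp_comap_atom [IsFiniteMeasure μ] (hH : Measurable H) {f : Ω → ℝ}
    (hf : Integrable f μ) {ω : Ω} (hω : 0 < μ.real (H ⁻¹' {H ω})) :
    (μ[f | MeasurableSpace.comap H inferInstance]) ω =
      (∫ x in H ⁻¹' {H ω}, f x ∂μ) / μ.real (H ⁻¹' {H ω}) := by
  rw [eq_div_iff hω.ne', condExp_comap_mul_atom hH hf]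

omit [MeasurableSpace X] [MeasurableSingletonClass X] in
lemma ae_atom_pos [IsFiniteMeasure μ] {S : Finset X} (hS : ∀ᵐ ω ∂μ, H ω ∈ S) :
    ∀ᵐ ω ∂μ, 0 < μ.real (H ⁻¹' {H ω}) := by
  have h : ∀ x ∈ S, ∀ᵐ ω ∂μ, H ω = x → 0 < μ.real (H ⁻¹' {H ω}) := fun x _ => by
    rcases eq_or_ne (μ (H ⁻¹' {x})) 0 with h0 | h0
    · filter_upwards [measure_eq_zero_iff_ae_notMem.1 h0] with ω hω hx
      exact absurd hx hω
    · refine Filter.Eventually.of_forall fun ω hω => ?_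
      rw [hω]
      exact ENNReal.toReal_pos h0 (measure_ne_top _ _)
  filter_upwards [hS, (Finset.eventually_all S).2 h] with ω h1 h2 using h2 _ h1 rfl

lemma exists_mem_of_ae {E : Set Ω} (hE : 0 < μ.real E) {Q : Ω → Prop} (hQ : ∀ᵐ ω ∂μ, Q ω) :
    ∃ ω ∈ E, Q ω := by
  by_contra! hcon
  have h0 : μ E = 0 := measure_mono_null (fun ω hω => hcon ω hω) hQ
  simp [Measure.real, h0] at hE

lemma integrable_comp_of_finite_range [IsFiniteMeasure μ] (hH : Measurable H) {S : Finset X}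
    (hS : ∀ᵐ ω ∂μ, H ω ∈ S) (G : X → ℝ) : Integrable (fun ω => G (H ω)) μ := by
  have h : IntegrableOn (fun ω => G (H ω)) (⋃ x ∈ S, H ⁻¹' {x}) μ :=
    integrableOn_finset_iUnion.2 fun x _ =>
      (integrableOn_const (C := G x) (measure_ne_top _ _)).congr_fun
        (fun ω hω => by rw [show H ω = x from hω]) (hH (measurableSet_singleton x))
  refine (integrableOn_univ (μ := μ)).1 (h.congr_set_ae ?_)
  filter_upwards [hS] with ω hω
  refine propext ⟨fun _ => ?_, fun _ => trivial⟩
  exact Set.mem_iUnion₂.2 ⟨H ω, hω, rfl⟩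

end Atoms

/-! ### Histories and their one-step extensions. -/

section History

variable {Ω : Type*} [MeasurableSpace Ω] {K : ℕ}

lemma measurable_history {A : ℕ → Ω → Fin K} {R : ℕ → Ω → Fin K → I} (hA : ∀ t, Measurable (A t))
    (hR : ∀ t, Measurable (R t)) (t : ℕ) : Measurable (history A R t) := by
  refine measurable_pi_lambda _ fun s => (hA s).prodMk ?_
  have h : Measurable fun x : (Fin K → I) × Fin K => x.1 x.2 :=
    measurable_from_prod_countable_left fun a => measurable_pi_apply a
  exact h.comp ((hR (s + 1)).prodMk (hA s))

omit [MeasurableSpace Ω] in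
lemma history_succ (A : ℕ → Ω → Fin K) (R : ℕ → Ω → Fin K → I) (t : ℕ) (ω : Ω) :
    history A R (t + 1) ω =
      Fin.snoc (α := fun _ => Fin K × I) (history A R t ω) (A t ω, R (t + 1) ω (A t ω)) := by
  ext s : 1
  refine Fin.lastCases ?_ (fun s => ?_) s <;> simp [history]

omit [MeasurableSpace Ω] in
lemma history_succ_eq_snoc {A : ℕ → Ω → Fin K} {R : ℕ → Ω → Fin K → I} {t : ℕ} {ω : Ω}
    {h : Fin t → Fin K × I} {a : Fin K} {y : I} :
    history A R (t + 1) ω = Fin.snoc (α := fun _ => Fin K × I) h (a, y) ↔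
      history A R t ω = h ∧ A t ω = a ∧ R (t + 1) ω a = y := by
  rw [history_succ, Fin.snoc_inj, Prod.mk.injEq]
  constructor
  · rintro ⟨h1, h2, h3⟩
    exact ⟨h1, h2, h2 ▸ h3⟩
  · rintro ⟨h1, h2, h3⟩
    exact ⟨h1, h2, by rw [h2, h3]⟩

/-- The histories of length `t` with rewards in `{0, 1}`. -/
def binaryHistories (K t : ℕ) : Finset (Fin t → Fin K × I) :=
  Fintype.piFinset fun _ => Finset.univ ×ˢ {0, 1}

end History

lemma measurable_meanReward {K : ℕ} (a : Fin K) :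
    Measurable fun ν : RewardLaw K => meanReward ν a := by
  have h : ∀ ν : RewardLaw K, meanReward ν a =
      (∫⁻ r, ENNReal.ofReal (r a : ℝ) ∂(ν : Measure (Fin K → I))).toReal := fun ν => by
    exact integral_eq_lintegral_of_nonneg_ae (Filter.Eventually.of_forall fun r => (r a).2.1)
      (measurable_subtype_coe.comp (measurable_pi_apply a)).aestronglyMeasurable
  simp only [h]
  exact ((Measure.measurable_lintegral
    (measurable_subtype_coe.comp (measurable_pi_apply a)).ennreal_ofReal).comp measurable_subtype_coe).ennreal_toReal

/-! ### The hard reward laws and the uniform prior. -/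

section Laws

variable {K : ℕ} {p ε : ℝ} {P : Fin K → RewardLaw K}

lemma HasHardMarginals.meanReward_eq (hP : HasHardMarginals p ε P) (i a : Fin K) :
    meanReward (P i) a = armMean p ε i a := by
  obtain ⟨q, hq, hmap⟩ := hP i a
  have h : meanReward (P i) a = ∫ y : I, (y : ℝ) ∂(P i : Measure (Fin K → I)).map (fun r => r a) :=
    (integral_map (φ := fun r : Fin K → I => r a) (measurable_pi_apply a).aemeasurable
      measurable_subtype_coe.aestronglyMeasurable).symm
  rw [h, hmap, integral_bernoulliMeasure]
  simp [hq, armMean]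

lemma HasHardMarginals.real_eq (hP : HasHardMarginals p ε P) (i a : Fin K) {y : I}
    (hy : y ∈ ({0, 1} : Finset I)) :
    (P i : Measure (Fin K → I)).real {r | r a = y} = armLik p ε i a y := by
  obtain ⟨q, hq, hmap⟩ := hP i a
  have h : (P i : Measure (Fin K → I)).real {r | r a = y} =
      ((P i : Measure (Fin K → I)).map (fun r => r a)).real {y} := by
    rw [map_measureReal_apply (by fun_prop) (measurableSet_singleton y)]
    rfl
  rw [h, hmap]
  simp only [Finset.mem_insert, Finset.mem_singleton] at hy
  rcases hy with rfl | rfl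
  · rw [bernoulliMeasure_real_apply_of_notMem_of_mem _ (measurableSet_singleton _) (by simp)
      (by simp)]
    simp [hq, armMean]
  · rw [bernoulliMeasure_real_apply_of_mem_of_notMem _ (measurableSet_singleton _) (by simp)
      (by simp)]
    simp [hq, armMean]

lemma HasHardMarginals.real_binary (hP : HasHardMarginals p ε P) (i a : Fin K) :
    (P i : Measure (Fin K → I)).real {r | r a ∈ ({0, 1} : Finset I)} = 1 := by
  have h : {r : Fin K → I | r a ∈ ({0, 1} : Finset I)} = {r | r a = 0} ∪ {r | r a = 1} := by
    ext r
    simp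
  rw [h, measureReal_union _ (measurableSet_eq_fun (by fun_prop) (by fun_prop)), hP.real_eq,
    hP.real_eq] <;> simp [Set.disjoint_left]
  intro r hr
  simp [hr]

lemma ae_of_map_eq_uniformPrior {Ω : Type*} [MeasurableSpace Ω] {μ : Measure Ω}
    {π : Ω → RewardLaw K} (hπ : Measurable π) (hprior : μ.map π = uniformPrior P)
    {Q : RewardLaw K → Prop} (hQm : MeasurableSet {ν | Q ν}) (hQ : ∀ j, Q (P j)) :
    ∀ᵐ ω ∂μ, Q (π ω) := by
  rw [← ae_map_iff hπ.aemeasurable hQm, hprior, ae_iff, uniformPrior,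
    Measure.finsetSum_apply]
  refine Finset.sum_eq_zero fun i _ => ?_
  have h : Measure.dirac (P i) {ν | ¬ Q ν} = 0 :=
    (Measure.dirac_apply' (P i) hQm.compl).trans (by simp [hQ i])
  rw [Measure.smul_apply, h, smul_zero]

end Laws

/-! ### Joint law of the history and the optimal action. -/

namespace BayesianBandit

variable {Ω : Type*} [MeasurableSpace Ω] {K : ℕ} {μ : Measure Ω} (B : BayesianBandit K μ)

/-- The event that the history up to time `t` is `h`. -/
def atom (t : ℕ) (h : Fin t → Fin K × I) : Set Ω := history B.A B.R t ⁻¹' {h}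

/-- The joint probability of the history `h` and the optimal action `i`. -/
def jointProb (t : ℕ) (h : Fin t → Fin K × I) (i : Fin K) : ℝ :=
  μ.real (B.atom t h ∩ B.AStar ⁻¹' {i})

/-- The posterior distribution of the optimal action after the history `h`. -/
def belief (t : ℕ) (h : Fin t → Fin K × I) (i : Fin K) : ℝ :=
  B.jointProb t h i / μ.real (B.atom t h)

lemma measurable_hist (t : ℕ) : Measurable (history B.A B.R t) :=
  measurable_history B.measurable_A B.measurable_R t

lemma measurableSet_atom (t : ℕ) (h : Fin t → Fin K × I) : MeasurableSet (B.atom t h) :=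
  B.measurable_hist t (measurableSet_singleton h)

lemma mem_atom {t : ℕ} {h : Fin t → Fin K × I} {ω : Ω} :
    ω ∈ B.atom t h ↔ history B.A B.R t ω = h := Iff.rfl

lemma atom_snoc (t : ℕ) (h : Fin t → Fin K × I) (a : Fin K) (y : I) :
    B.atom (t + 1) (Fin.snoc (α := fun _ => Fin K × I) h (a, y)) =
      B.atom t h ∩ B.A t ⁻¹' {a} ∩ B.R (t + 1) ⁻¹' {r | r a = y} := by
  ext ω
  simp only [mem_atom, history_succ_eq_snoc, Set.mem_inter_iff, Set.mem_preimage,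
    Set.mem_singleton_iff, Set.mem_ofPred_eq, and_assoc]

lemma measurableSet_AStar (i : Fin K) : MeasurableSet (B.AStar ⁻¹' {i}) :=
  B.measurable_AStar (measurableSet_singleton i)

lemma measurableSet_A (t : ℕ) (a : Fin K) : MeasurableSet (B.A t ⁻¹' {a}) :=
  B.measurable_A t (measurableSet_singleton a)

lemma sum_real_inter_AStar [IsFiniteMeasure μ] {E : Set Ω} (hE : MeasurableSet E) :
    ∑ i, μ.real (E ∩ B.AStar ⁻¹' {i}) = μ.real E := by
  rw [← measureReal_biUnion_finset]
  · congr 1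
    ext ω
    simp
  · intro i _ j _ hij
    refine Set.disjoint_left.2 fun ω h1 h2 => hij ?_
    exact h1.2.symm.trans h2.2
  · exact fun i _ => hE.inter (B.measurableSet_AStar i)

lemma sum_jointProb [IsFiniteMeasure μ] (t : ℕ) (h : Fin t → Fin K × I) :
    ∑ i, B.jointProb t h i = μ.real (B.atom t h) :=
  B.sum_real_inter_AStar (B.measurableSet_atom t h)

lemma sum_belief [IsFiniteMeasure μ] {t : ℕ} {h : Fin t → Fin K × I}
    (hW : 0 < μ.real (B.atom t h)) : ∑ i, B.belief t h i = 1 := by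
  simp only [belief]
  rw [← Finset.sum_div, B.sum_jointProb, div_self hW.ne']

lemma atom_mul_belief {t : ℕ} {h : Fin t → Fin K × I}
    (hW : 0 < μ.real (B.atom t h)) (i : Fin K) :
    μ.real (B.atom t h) * B.belief t h i = B.jointProb t h i :=
  mul_div_cancel₀ _ hW.ne'

lemma measurableSet_R_inter (S : Finset ℕ) {C : ℕ → Set (Fin K → I)}
    (hC : ∀ s, MeasurableSet (C s)) : MeasurableSet (⋂ s ∈ S, B.R (s + 1) ⁻¹' C s) :=
  Finset.measurableSet_biInter S fun s _ => B.measurable_R (s + 1) (hC s)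

/-- The σ-algebra generated by `H_t`, `p_*`, `A_*` and all the reward vectors. -/
abbrev fullSigma (t : ℕ) : MeasurableSpace Ω :=
  historySigma B.A B.R t ⊔ MeasurableSpace.comap B.pStar inferInstance ⊔
    MeasurableSpace.comap B.AStar inferInstance ⊔
    ⨆ s, MeasurableSpace.comap (B.R (s + 1)) inferInstance

lemma fullSigma_le (t : ℕ) : B.fullSigma t ≤ ‹MeasurableSpace Ω› :=
  sup_le (sup_le (sup_le (B.measurable_hist t).comap_le B.measurable_pStar.comap_le)
    B.measurable_AStar.comap_le) (iSup_le fun s => (B.measurable_R (s + 1)).comap_le)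

/-- Given the history, the agent draws its action independently of everything else. -/
lemma real_inter_action [IsProbabilityMeasure μ] {t : ℕ} {h : Fin t → Fin K × I} (a : Fin K)
    (i : Fin K) (S : Finset ℕ) {C : ℕ → Set (Fin K → I)} (hC : ∀ s, MeasurableSet (C s)) :
    μ.real (B.atom t h ∩ B.AStar ⁻¹' {i} ∩ (⋂ s ∈ S, B.R (s + 1) ⁻¹' C s) ∩ B.A t ⁻¹' {a}) *
      μ.real (B.atom t h) = μ.real (B.atom t h ∩ B.A t ⁻¹' {a}) *
        μ.real (B.atom t h ∩ B.AStar ⁻¹' {i} ∩ ⋂ s ∈ S, B.R (s + 1) ⁻¹' C s) := by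
  set E := B.atom t h ∩ B.AStar ⁻¹' {i} ∩ ⋂ s ∈ S, B.R (s + 1) ⁻¹' C s with hE
  have hmle := B.fullSigma_le t
  have hEm : MeasurableSet[B.fullSigma t] E := by
    refine @MeasurableSet.inter _ (_) _ _ (@MeasurableSet.inter _ (_) _ _ ?_ ?_) ?_
    · have hle : historySigma B.A B.R t ≤ B.fullSigma t :=
        le_sup_left.trans (le_sup_left.trans le_sup_left)
      exact hle _ ⟨{h}, measurableSet_singleton h, rfl⟩
    · have hle : MeasurableSpace.comap B.AStar inferInstance ≤ B.fullSigma t :=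
        le_sup_right.trans le_sup_left
      exact hle _ ⟨{i}, measurableSet_singleton i, rfl⟩
    · refine @Finset.measurableSet_biInter _ _ (_) _ S fun s _ => ?_
      have hle : MeasurableSpace.comap (B.R (s + 1)) inferInstance ≤ B.fullSigma t :=
        (le_iSup (fun s => MeasurableSpace.comap (B.R (s + 1)) inferInstance) s).trans le_sup_right
      exact hle _ ⟨C s, hC s, rfl⟩
  have hA := B.measurableSet_A t a
  have hint : Integrable ((B.A t ⁻¹' {a}).indicator fun _ => (1 : ℝ)) μ :=
    (integrable_const 1).indicator hA
  have hindic : ∀ D : Set Ω, ∫ ω in D, (B.A t ⁻¹' {a}).indicator (fun _ => (1 : ℝ)) ω ∂μ =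
      μ.real (D ∩ B.A t ⁻¹' {a}) := fun D => by
    rw [setIntegral_indicator hA]
    simp
  have hpol : μ⟦B.A t ⁻¹' {a} | B.fullSigma t⟧ =ᵐ[μ] μ⟦B.A t ⁻¹' {a} | historySigma B.A B.R t⟧ :=
    B.policy t a
  have h1 := setIntegral_condExp hmle hint hEm
  rw [hindic, setIntegral_congr_ae (g := (μ⟦B.A t ⁻¹' {a} | historySigma B.A B.R t⟧))
    (hmle _ hEm) (hpol.mono fun ω hω _ => hω)] at h1
  rw [← h1, ← integral_mul_const, setIntegral_congr_fun (hmle _ hEm)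
    (g := fun _ => μ.real (B.atom t h ∩ B.A t ⁻¹' {a}))]
  · simp [mul_comm]
  · intro ω hω
    have hωh : history B.A B.R t ω = h := hω.1.1
    have := condExp_comap_mul_atom (B.measurable_hist t) hint ω
    rw [hindic, hωh] at this
    exact this

section Hard

variable [IsProbabilityMeasure μ] {p ε : ℝ} (hp : p ∈ Set.Ioo (0 : ℝ) 1)
  (hε : ε ∈ Set.Ioo 0 (1 - p)) {P : Fin K → RewardLaw K} (hP : HasHardMarginals p ε P)
  (hprior : μ.map B.pStar = uniformPrior P)

include hε hP hprior

omit [IsProbabilityMeasure μ] in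
-- In each environment the arm with mean `p + ε` is the only maximizer, so `A_*` is the index of the
-- environment.
lemma ae_meanReward_eq :
    ∀ᵐ ω ∂μ, ∀ k, meanReward (B.pStar ω) k = armMean p ε (B.AStar ω) k := by
  have hQ : ∀ᵐ ω ∂μ, ∃ j, ∀ k, meanReward (B.pStar ω) k = armMean p ε j k := by
    refine ae_of_map_eq_uniformPrior (Q := fun ν => ∃ j, ∀ k, meanReward ν k = armMean p ε j k)
      B.measurable_pStar hprior ?_ fun j => ⟨j, hP.meanReward_eq j⟩
    have : {ν : RewardLaw K | ∃ j, ∀ k, meanReward ν k = armMean p ε j k} =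
        ⋃ j, ⋂ k, {ν | meanReward ν k = armMean p ε j k} := by
      ext ν
      simp
    rw [this]
    exact MeasurableSet.iUnion fun j => MeasurableSet.iInter fun k =>
      measurable_meanReward k (measurableSet_singleton _)
  filter_upwards [hQ, B.optimal] with ω ⟨j, hj⟩ hopt
  have h := hopt j
  rw [hj, hj, armMean, if_pos rfl, armMean] at h
  have hjA : j = B.AStar ω := by
    by_contra hne
    rw [if_neg hne] at h
    linarith [hε.1]
  rwa [← hjA]

omit [IsProbabilityMeasure μ] in
lemma ae_RStar_eq : B.RStar =ᵐ[μ] fun _ => p + ε := by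
  filter_upwards [B.ae_meanReward_eq hε hP hprior] with ω hω
  have : Nonempty (Fin K) := ⟨B.AStar ω⟩
  simp only [RStar, hω]
  refine ciSup_eq_of_forall_le_of_forall_lt_exists_gt (fun k => ?_) fun w hw => ⟨B.AStar ω, ?_⟩
  · unfold armMean
    split_ifs
    · exact le_rfl
    · linarith [hε.1]
  · simpa [armMean] using hw

lemma real_AStar_inter (i : Fin K) (S : Finset ℕ) {C : ℕ → Set (Fin K → I)}
    (hC : ∀ s, MeasurableSet (C s)) :
    μ.real (B.AStar ⁻¹' {i} ∩ ⋂ s ∈ S, B.R (s + 1) ⁻¹' C s) =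
      (K : ℝ)⁻¹ * ∏ s ∈ S, (P i : Measure (Fin K → I)).real (C s) := by
  have hD : MeasurableSet {ν : RewardLaw K | meanReward ν i = p + ε} :=
    measurable_meanReward i (measurableSet_singleton _)
  have hmem : ∀ j, meanReward (P j) i = p + ε ↔ j = i := fun j => by
    rw [hP.meanReward_eq, armMean]
    split_ifs with hji
    · simp [hji]
    · simp [hji, hε.1.ne']
  -- Stand-in for the event that `p_*` is `P i`: it is measurable because mean rewards are, and
  -- among the laws `P j` it selects exactly `P i`.
  set Θ := B.pStar ⁻¹' {ν : RewardLaw K | meanReward ν i = p + ε} with hΘ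
  have hΘm : MeasurableSet[MeasurableSpace.comap B.pStar inferInstance] Θ := ⟨_, hD, rfl⟩
  have hle := B.measurable_pStar.comap_le
  have hΘA : (B.AStar ⁻¹' {i} : Set Ω) =ᵐ[μ] Θ := by
    filter_upwards [B.ae_meanReward_eq hε hP hprior] with ω hω
    refine propext ⟨fun h => ?_, fun h => ?_⟩
    · have hi : B.AStar ω = i := h
      exact (hω i).trans (by rw [hi, armMean, if_pos rfl])
    · have hi : meanReward (B.pStar ω) i = p + ε := h
      rw [hω, armMean] at hi
      by_contra hne
      have hne' : B.AStar ω ≠ i := hne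
      rw [if_neg hne'] at hi
      linarith [hε.1]
  have hΘK : μ.real Θ = (K : ℝ)⁻¹ := by
    rw [hΘ, ← map_measureReal_apply B.measurable_pStar hD, hprior, uniformPrior, Measure.real,
      Measure.finsetSum_apply]
    have : ∀ j, ((K : ℝ≥0∞)⁻¹ • Measure.dirac (P j)) {ν : RewardLaw K | meanReward ν i = p + ε} =
        if j = i then (K : ℝ≥0∞)⁻¹ else 0 := fun j => by
      rw [Measure.smul_apply, Measure.dirac_apply' _ hD]
      by_cases hji : j = i <;> simp [Set.indicator, hmem, hji]
    simp [this]
  have hRm := B.measurableSet_R_inter S hC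
  have hint : Integrable ((⋂ s ∈ S, B.R (s + 1) ⁻¹' C s).indicator fun _ => (1 : ℝ)) μ :=
    (integrable_const 1).indicator hRm
  have hprod : ∀ᵐ ω ∂μ, meanReward (B.pStar ω) i = p + ε →
      ∏ s ∈ S, (B.pStar ω : Measure (Fin K → I)).real (C s) =
        ∏ s ∈ S, (P i : Measure (Fin K → I)).real (C s) := by
    refine ae_of_map_eq_uniformPrior (Q := fun ν : RewardLaw K => meanReward ν i = p + ε →
      ∏ s ∈ S, (ν : Measure (Fin K → I)).real (C s) =
        ∏ s ∈ S, (P i : Measure (Fin K → I)).real (C s)) B.measurable_pStar hprior ?_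
      fun j hj => by rw [(hmem j).1 hj]
    refine MeasurableSet.imp hD ?_
    have hmeas : Measurable fun ν : RewardLaw K =>
        ∏ s ∈ S, (ν : Measure (Fin K → I)).real (C s) :=
      Finset.measurable_fun_prod S fun s _ =>
        ((Measure.measurable_coe (hC s)).comp measurable_subtype_coe).ennreal_toReal
    exact hmeas (measurableSet_singleton _)
  have h1 := setIntegral_condExp hle hint hΘm
  rw [setIntegral_congr_ae (g := fun _ => ∏ s ∈ S, (P i : Measure (Fin K → I)).real (C s))
    (hle _ hΘm) (by
      filter_upwards [B.cond_iid S C hC, hprod] with ω h2 h3 h4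
      exact h2.trans (h3 h4)), setIntegral_indicator hRm] at h1
  simp only [setIntegral_const, smul_eq_mul, mul_one] at h1
  rw [← hΘK, h1]
  exact measureReal_congr (hΘA.inter (ae_eq_refl _))

/-- Given the optimal action, future rewards are independent of the history. -/
lemma real_atom_inter (i : Fin K) {C : ℕ → Set (Fin K → I)} (hC : ∀ s, MeasurableSet (C s))
    (t : ℕ) (h : Fin t → Fin K × I) (S : Finset ℕ) (hS : ∀ s ∈ S, t ≤ s) :
    μ.real (B.atom t h ∩ B.AStar ⁻¹' {i} ∩ ⋂ s ∈ S, B.R (s + 1) ⁻¹' C s) =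
      B.jointProb t h i * ∏ s ∈ S, (P i : Measure (Fin K → I)).real (C s) := by
  induction t generalizing S C with
  | zero =>
    have h0 : B.atom 0 h = Set.univ := by
      ext ω
      simp [mem_atom, Subsingleton.elim _ h]
    have h1 := B.real_AStar_inter hε hP hprior i ∅ hC
    simp only [Finset.notMem_empty, Set.iInter_of_empty, Set.iInter_univ, Set.inter_univ,
      Finset.prod_empty, mul_one] at h1
    rw [jointProb, h0, Set.univ_inter, h1, B.real_AStar_inter hε hP hprior i S hC]
  | succ t ih =>
    obtain ⟨h', a, y, rfl⟩ : ∃ h' a y, h = Fin.snoc (α := fun _ => Fin K × I) h' (a, y) :=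
      ⟨Fin.init h, (h (Fin.last t)).1, (h (Fin.last t)).2, (Fin.snoc_init_self h).symm⟩
    have hy : MeasurableSet {r : Fin K → I | r a = y} :=
      measurableSet_eq_fun (measurable_pi_apply a) measurable_const
    -- The last reward of the longer history counts as a future reward of its prefix `h'`, so index
    -- `t` joins the constraints `C'`. Multiplying by the mass of the prefix avoids a division.
    have step : ∀ S' : Finset ℕ, (∀ s ∈ S', t + 1 ≤ s) →
        μ.real (B.atom (t + 1) (Fin.snoc (α := fun _ => Fin K × I) h' (a, y)) ∩ B.AStar ⁻¹' {i} ∩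
          ⋂ s ∈ S', B.R (s + 1) ⁻¹' C s) * μ.real (B.atom t h') =
        μ.real (B.atom t h' ∩ B.A t ⁻¹' {a}) * (B.jointProb t h' i *
          ((P i : Measure (Fin K → I)).real {r | r a = y} *
            ∏ s ∈ S', (P i : Measure (Fin K → I)).real (C s))) := by
      intro S' hS'
      have htS : t ∉ S' := fun ht => by simpa using hS' t ht
      set C' := Function.update C t {r | r a = y} with hC'
      have hC'm : ∀ s, MeasurableSet (C' s) := fun s => by
        rcases eq_or_ne s t with rfl | hst
        · simpa [hC'] using hy
        · simpa [hC', hst] using hC s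
      have hCC : ∀ s ∈ S', C' s = C s := fun s hs =>
        Function.update_of_ne (by rintro rfl; exact htS hs) _ _
      have h1 := B.real_inter_action (t := t) (h := h') a i (insert t S') hC'm
      rw [ih hC'm h' (insert t S') (fun s hs => by
        rcases Finset.mem_insert.1 hs with rfl | hs
        · exact le_rfl
        · exact (Nat.le_succ t).trans (hS' s hs)), Finset.prod_insert htS,
        Finset.prod_congr rfl fun s hs => by rw [hCC s hs]] at h1
      rw [show C' t = {r | r a = y} by simp [hC']] at h1
      rw [← h1]
      congr 2
      rw [atom_snoc, Finset.set_biInter_insert, show C' t = {r | r a = y} by simp [hC'],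
        show (⋂ s ∈ S', B.R (s + 1) ⁻¹' C' s) = ⋂ s ∈ S', B.R (s + 1) ⁻¹' C s from
          Set.iInter₂_congr fun s hs => by rw [hCC s hs]]
      ext ω
      simp only [Set.mem_inter_iff]
      tauto
    have h1 := step S hS
    have h0 := step ∅ (by simp)
    simp only [Finset.notMem_empty, Set.iInter_of_empty, Set.iInter_univ, Set.inter_univ,
      Finset.prod_empty, mul_one] at h0
    -- A null prefix cannot be cancelled, but then both sides vanish.
    rcases (measureReal_nonneg (μ := μ) (s := B.atom t h')).eq_or_lt with hW | hW
    · have hz : ∀ D ⊆ B.atom t h', μ.real D = 0 := fun D hD =>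
        le_antisymm ((measureReal_mono hD).trans hW.symm.le) measureReal_nonneg
      rw [jointProb, hz, hz, zero_mul]
      all_goals
        rw [atom_snoc]
        intro ω hω
        simp only [Set.mem_inter_iff] at hω
        tauto
    · refine mul_right_cancel₀ hW.ne' ?_
      rw [h1, mul_right_comm, show B.jointProb (t + 1) _ i * μ.real (B.atom t h') = _ from h0]
      ring

/-- Bayes' rule before normalization: the probability of choosing `a` does not depend on `i`, so
only the likelihood reweights the optimal actions. -/
lemma jointProb_snoc (t : ℕ) (h : Fin t → Fin K × I) (i a : Fin K) {y : I}
    (hy : y ∈ ({0, 1} : Finset I)) :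
    B.jointProb (t + 1) (Fin.snoc (α := fun _ => Fin K × I) h (a, y)) i * μ.real (B.atom t h) =
      μ.real (B.atom t h ∩ B.A t ⁻¹' {a}) * (B.jointProb t h i * armLik p ε i a y) := by
  have hym : MeasurableSet {r : Fin K → I | r a = y} :=
    measurableSet_eq_fun (measurable_pi_apply a) measurable_const
  have h1 := B.real_inter_action (t := t) (h := h) a i {t} (C := fun _ => {r | r a = y})
    fun _ => hym
  rw [B.real_atom_inter hε hP hprior i (fun _ => hym) t h {t} (by simp), Finset.prod_singleton,
    hP.real_eq i a hy] at h1
  rw [← h1, jointProb, atom_snoc]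
  congr 2
  ext ω
  simp only [Set.mem_inter_iff, Finset.mem_singleton, Set.iInter_iInter_eq_left]
  tauto

lemma jointProb_zero (h : Fin 0 → Fin K × I) (i : Fin K) : B.jointProb 0 h i = (K : ℝ)⁻¹ := by
  have h0 : B.atom 0 h = Set.univ := by
    ext ω
    simp [mem_atom, Subsingleton.elim _ h]
  have h1 := B.real_AStar_inter hε hP hprior i ∅ (C := fun _ => ∅) (by simp)
  rw [jointProb, h0, Set.univ_inter]
  simpa using h1

lemma ae_reward_binary (t : ℕ) (a : Fin K) :
    ∀ᵐ ω ∂μ, B.R (t + 1) ω a ∈ ({0, 1} : Finset I) := by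
  have hm : MeasurableSet {r : Fin K → I | r a ∈ ({0, 1} : Finset I)} :=
    measurable_pi_apply a (Finset.measurableSet ({0, 1} : Finset I))
  have hRm := B.measurable_R (t + 1) hm
  have hKpos : (K : ℝ) ≠ 0 := Nat.cast_ne_zero.2 a.pos.ne'
  have h1 := B.sum_real_inter_AStar hRm
  have h2 : ∀ i, μ.real (B.R (t + 1) ⁻¹' {r | r a ∈ ({0, 1} : Finset I)} ∩ B.AStar ⁻¹' {i}) =
      (K : ℝ)⁻¹ := fun i => by
    have := B.real_AStar_inter hε hP hprior i {t}
      (C := fun _ => {r | r a ∈ ({0, 1} : Finset I)}) fun _ => hm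
    rw [Finset.prod_singleton, hP.real_binary, mul_one] at this
    rw [Set.inter_comm, ← this]
    simp only [Finset.mem_singleton, Set.iInter_iInter_eq_left]
  simp only [h2, Finset.sum_const, Finset.card_univ, Fintype.card_fin, nsmul_eq_mul,
    mul_inv_cancel₀ hKpos] at h1
  exact (mem_ae_iff_prob_eq_one hRm).2 (by
    rw [← ENNReal.toReal_eq_one_iff]
    exact h1.symm)

lemma ae_history_mem (t : ℕ) : ∀ᵐ ω ∂μ, history B.A B.R t ω ∈ binaryHistories K t := by
  have h : ∀ᵐ ω ∂μ, ∀ (s : Fin t) (a : Fin K), B.R (s + 1) ω a ∈ ({0, 1} : Finset I) :=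
    ae_all_iff.2 fun s => ae_all_iff.2 fun a => B.ae_reward_binary hε hP hprior s a
  filter_upwards [h] with ω hω
  refine Fintype.mem_piFinset.2 fun s => Finset.mem_product.2 ⟨Finset.mem_univ _, hω s _⟩

include hp

/-- Both rewards have positive probability in every environment, so no finite binary history rules
out an optimal action. Beliefs are therefore interior, as the divergence formula requires. -/
lemma jointProb_pos {t : ℕ} {h : Fin t → Fin K × I} (hh : h ∈ binaryHistories K t)
    (hW : 0 < μ.real (B.atom t h)) (i : Fin K) : 0 < B.jointProb t h i := by
  induction t with
  | zero =>
    rw [B.jointProb_zero hε hP hprior]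
    exact inv_pos.2 (Nat.cast_pos.2 i.pos)
  | succ t ih =>
    obtain ⟨h', a, y, rfl⟩ : ∃ h' a y, h = Fin.snoc (α := fun _ => Fin K × I) h' (a, y) :=
      ⟨Fin.init h, (h (Fin.last t)).1, (h (Fin.last t)).2, (Fin.snoc_init_self h).symm⟩
    rw [binaryHistories, Fintype.mem_piFinset] at hh
    have hy : y ∈ ({0, 1} : Finset I) := by
      have := (Finset.mem_product.1 (hh (Fin.last t))).2
      simpa using this
    have hh' : h' ∈ binaryHistories K t := Fintype.mem_piFinset.2 fun s => by
      have := hh s.castSucc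
      rwa [Fin.snoc_castSucc] at this
    rw [atom_snoc] at hW
    have hW1 : 0 < μ.real (B.atom t h' ∩ B.A t ⁻¹' {a}) :=
      hW.trans_le (measureReal_mono Set.inter_subset_left)
    have hW2 : 0 < μ.real (B.atom t h') := hW1.trans_le (measureReal_mono Set.inter_subset_left)
    refine pos_of_mul_pos_left ?_ hW2.le
    rw [B.jointProb_snoc hε hP hprior t h' i a hy]
    exact mul_pos hW1 (mul_pos (ih hh' hW2) (armLik_pos hp hε i a y))

lemma belief_pos {t : ℕ} {h : Fin t → Fin K × I} (hh : h ∈ binaryHistories K t)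
    (hW : 0 < μ.real (B.atom t h)) (i : Fin K) : 0 < B.belief t h i :=
  div_pos (B.jointProb_pos hp hε hP hprior hh hW i) hW

end Hard

end BayesianBandit

/-! ### Posterior dynamics under Thompson sampling. -/

namespace BayesianBandit

variable {Ω : Type*} [MeasurableSpace Ω] {K : ℕ} {μ : Measure Ω} (B : BayesianBandit K μ)

/-- A history with rewards in `{0, 1}` that occurs with positive probability. -/
def Feasible (t : ℕ) (h : Fin t → Fin K × I) : Prop :=
  h ∈ binaryHistories K t ∧ 0 < μ.real (B.atom t h)

/-- The posterior distribution of the optimal action, as a function of the observed history. -/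
def beliefAt (t : ℕ) (ω : Ω) : Fin K → ℝ := B.belief t (history B.A B.R t ω)

variable [IsProbabilityMeasure μ]

lemma posterior_eq_beliefAt {t : ℕ} {ω : Ω} (hω : B.Feasible t (history B.A B.R t ω)) :
    B.posterior t ω = B.beliefAt t ω := by
  ext a
  have hA := B.measurableSet_AStar a
  have h := condExp_comap_atom (B.measurable_hist t) (ω := ω)
    ((integrable_const (1 : ℝ)).indicator hA) hω.2
  rw [setIntegral_indicator hA] at h
  simp only [setIntegral_const, smul_eq_mul, mul_one] at h
  exact h

/-- Probability matching holds almost everywhere, hence at some point of an atom of positive mass;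
both conditional probabilities are constant on the atom. -/
lemma real_inter_action_eq (hTS : B.IsThompsonSampling) {t : ℕ} {h : Fin t → Fin K × I}
    (hh : B.Feasible t h) (a : Fin K) :
    μ.real (B.atom t h ∩ B.A t ⁻¹' {a}) = B.jointProb t h a := by
  obtain ⟨ω, rfl, hω⟩ := exists_mem_of_ae hh.2 (hTS t a)
  have hA := B.measurableSet_A t a
  have h := condExp_comap_mul_atom (B.measurable_hist t)
    ((integrable_const (μ := μ) (1 : ℝ)).indicator hA) ω
  rw [setIntegral_indicator hA] at h
  simp only [setIntegral_const, smul_eq_mul, mul_one] at h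
  rw [B.posterior_eq_beliefAt hh] at hω
  exact h.symm.trans ((congrArg (· * _) hω).trans ((mul_comm _ _).trans
    (B.atom_mul_belief hh.2 a)))

lemma sum_beliefAt {t : ℕ} {ω : Ω} (hω : B.Feasible t (history B.A B.R t ω)) :
    ∑ i, B.beliefAt t ω i = 1 := B.sum_belief hω.2

section Hard

variable {p ε : ℝ} (hp : p ∈ Set.Ioo (0 : ℝ) 1) (hε : ε ∈ Set.Ioo 0 (1 - p))
  {P : Fin K → RewardLaw K} (hP : HasHardMarginals p ε P) (hprior : μ.map B.pStar = uniformPrior P)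

include hε hP hprior

lemma ae_feasible (t : ℕ) : ∀ᵐ ω ∂μ, B.Feasible t (history B.A B.R t ω) :=
  (B.ae_history_mem hε hP hprior t).and (ae_atom_pos (B.ae_history_mem hε hP hprior t))

lemma integrable_history (t : ℕ) (G : (Fin t → Fin K × I) → ℝ) :
    Integrable (fun ω => G (history B.A B.R t ω)) μ :=
  integrable_comp_of_finite_range (B.measurable_hist t) (B.ae_history_mem hε hP hprior t) G

lemma expRegret_eq {t : ℕ} (a : Fin K) :
    ∀ᵐ ω ∂μ, B.expRegret t a ω = ε * (1 - B.beliefAt t ω a) := by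
  have hbin := B.ae_reward_binary hε hP hprior t a
  have hm : MeasurableSet {r : Fin K → I | r a = 1} :=
    measurableSet_eq_fun (measurable_pi_apply a) measurable_const
  have hRm := B.measurable_R (t + 1) hm
  have hint : Integrable (fun ω => p + ε -
      (B.R (t + 1) ⁻¹' {r | r a = 1}).indicator (fun _ => (1 : ℝ)) ω) μ :=
    (integrable_const _).sub ((integrable_const _).indicator hRm)
  -- A binary reward equals the indicator that it is 1, so its conditional mean is a ratio of event
  -- probabilities.
  have hae : (fun ω => B.RStar ω - (B.R (t + 1) ω a : ℝ)) =ᵐ[μ] fun ω => p + ε -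
      (B.R (t + 1) ⁻¹' {r | r a = 1}).indicator (fun _ => (1 : ℝ)) ω := by
    filter_upwards [B.ae_RStar_eq hε hP hprior, hbin] with ω h1 h2
    simp only [Finset.mem_insert, Finset.mem_singleton] at h2
    rw [h1]
    rcases h2 with h2 | h2 <;> simp [h2, Set.indicator]
  filter_upwards [condExp_congr_ae (m := B.hist t) hae, B.ae_feasible hε hP hprior t]
    with ω h1 hω
  rw [expRegret, h1, condExp_comap_atom (B.measurable_hist t) hint hω.2,
    integral_sub (integrable_const _) ((integrable_const _).indicator hRm),
    setIntegral_indicator hRm]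
  refine (div_eq_iff hω.2.ne').2 ?_
  simp only [setIntegral_const, smul_eq_mul, mul_one]
  set h := history B.A B.R t ω
  change μ.real (B.atom t h) * (p + ε) - μ.real (B.atom t h ∩ _) = _ * μ.real (B.atom t h)
  have h2 : μ.real (B.atom t h ∩ B.R (t + 1) ⁻¹' {r | r a = 1}) =
      μ.real (B.atom t h) * (p + ε * B.beliefAt t ω a) := by
    rw [← B.sum_real_inter_AStar ((B.measurableSet_atom t h).inter hRm),
      beliefAt, ← sum_mul_armMean (B.sum_belief hω.2), Finset.mul_sum]
    refine Finset.sum_congr rfl fun i _ => ?_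
    have h3 := B.real_atom_inter hε hP hprior i (C := fun _ => {r | r a = 1}) (fun _ => hm) t h {t}
      (by simp)
    rw [Finset.prod_singleton, hP.real_eq i a (by simp), armLik_one,
      ← B.atom_mul_belief hω.2 i] at h3
    rw [← mul_assoc, ← h3]
    congr 1
    ext x
    simp only [Set.mem_inter_iff, Finset.mem_singleton, Set.iInter_iInter_eq_left]
    tauto
  rw [h2]
  ring

include hp in
lemma beliefAt_pos {t : ℕ} {ω : Ω} (hω : B.Feasible t (history B.A B.R t ω)) (i : Fin K) :
    0 < B.beliefAt t ω i := B.belief_pos hp hε hP hprior hω.1 hω.2 i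

lemma integrable_regret_step (t : ℕ) :
    Integrable (fun ω => B.RStar ω - (B.R (t + 1) ω (B.A t ω) : ℝ)) μ := by
  refine (B.integrable_history hε hP hprior (t + 1)
    fun h => p + ε - ((h (Fin.last t)).2 : ℝ)).congr ?_
  filter_upwards [B.ae_RStar_eq hε hP hprior] with ω hω
  rw [hω]
  rfl

lemma integrable_beliefAt (t : ℕ) (φ : (Fin K → ℝ) → ℝ) :
    Integrable (fun ω => φ (B.beliefAt t ω)) μ :=
  B.integrable_history hε hP hprior t fun h => φ (B.belief t h)

variable (hTS : B.IsThompsonSampling)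

include hTS

lemma real_atom_snoc {t : ℕ} {h : Fin t → Fin K × I} (hh : B.Feasible t h) (a : Fin K) {y : I}
    (hy : y ∈ ({0, 1} : Finset I)) :
    μ.real (B.atom (t + 1) (Fin.snoc (α := fun _ => Fin K × I) h (a, y))) =
      B.jointProb t h a * mixLik p ε (B.belief t h) a y := by
  refine mul_right_cancel₀ hh.2.ne' ?_
  rw [← sum_jointProb, Finset.sum_mul, mixLik, Finset.mul_sum, Finset.sum_mul]
  refine Finset.sum_congr rfl fun i _ => ?_
  rw [B.jointProb_snoc hε hP hprior t h i a hy, B.real_inter_action_eq hTS hh,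
    ← B.atom_mul_belief hh.2 i]
  ring

include hp

lemma belief_snoc {t : ℕ} {h : Fin t → Fin K × I} (hh : B.Feasible t h) (a : Fin K) {y : I}
    (hy : y ∈ ({0, 1} : Finset I)) :
    B.belief (t + 1) (Fin.snoc (α := fun _ => Fin K × I) h (a, y)) =
      bayesUpdate p ε (B.belief t h) a y := by
  ext i
  have hJ := B.jointProb_pos hp hε hP hprior hh.1 hh.2 a
  have hm := mixLik_pos hp hε (B.belief_pos hp hε hP hprior hh.1 hh.2) a y
  rw [belief, B.real_atom_snoc hε hP hprior hTS hh a hy, bayesUpdate,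
    div_eq_div_iff (mul_pos hJ hm).ne' hm.ne']
  have h1 := B.jointProb_snoc hε hP hprior t h i a hy
  rw [B.real_inter_action_eq hTS hh, ← B.atom_mul_belief hh.2 i] at h1
  have h2 : B.jointProb (t + 1) (Fin.snoc (α := fun _ => Fin K × I) h (a, y)) i =
      B.jointProb t h a * (B.belief t h i * armLik p ε i a y) :=
    mul_right_cancel₀ hh.2.ne' (h1.trans (by ring))
  rw [h2]
  ring

omit hp

/-- The one-step predictive distribution of the history under Thompson sampling. -/
lemma condExp_history_succ {t : ℕ} (G : (Fin (t + 1) → Fin K × I) → ℝ) {ω : Ω}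
    (hω : B.Feasible t (history B.A B.R t ω)) :
    (μ[fun ω => G (history B.A B.R (t + 1) ω) | B.hist t]) ω =
      ∑ a, B.beliefAt t ω a * predict p ε (B.beliefAt t ω) a fun y =>
        G (Fin.snoc (α := fun _ => Fin K × I) (history B.A B.R t ω) (a, y)) := by
  rw [condExp_comap_atom (B.measurable_hist t) (B.integrable_history hε hP hprior (t + 1) G) hω.2]
  refine (div_eq_iff hω.2.ne').2 ?_
  simp only [beliefAt]
  set h := history B.A B.R t ω
  let N := (Finset.univ : Finset (Fin K)) ×ˢ ({0, 1} : Finset I)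
  -- Up to a null set, the atom of `h` splits into its extensions by an action and a binary reward.
  have hset : (history B.A B.R t ⁻¹' {h} : Set Ω) =ᵐ[μ]
      ⋃ x ∈ N, B.atom (t + 1) (Fin.snoc (α := fun _ => Fin K × I) h x) := by
    have hbin : ∀ᵐ ω ∂μ, ∀ a, B.R (t + 1) ω a ∈ ({0, 1} : Finset I) :=
      ae_all_iff.2 fun a => B.ae_reward_binary hε hP hprior t a
    filter_upwards [hbin] with x hx
    refine propext ⟨fun hxh => ?_, fun hxh => ?_⟩
    · refine Set.mem_iUnion₂.2 ⟨(B.A t x, B.R (t + 1) x (B.A t x)),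
        Finset.mem_product.2 ⟨Finset.mem_univ _, hx _⟩, ?_⟩
      exact history_succ_eq_snoc.2 ⟨hxh, rfl, rfl⟩
    · obtain ⟨z, _, hz⟩ := Set.mem_iUnion₂.1 hxh
      exact (history_succ_eq_snoc.1 hz).1
  rw [setIntegral_congr_set hset, integral_biUnion_finset]
  · rw [Finset.sum_product, Finset.sum_mul]
    refine Finset.sum_congr rfl fun a _ => ?_
    rw [predict, Finset.mul_sum, Finset.sum_mul]
    refine Finset.sum_congr rfl fun y hy => ?_
    rw [setIntegral_congr_fun (B.measurableSet_atom _ _)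
      (g := fun _ => G (Fin.snoc (α := fun _ => Fin K × I) h (a, y)))
      (fun x hx => congrArg G hx), setIntegral_const, smul_eq_mul,
      B.real_atom_snoc hε hP hprior hTS hω a hy, ← B.atom_mul_belief hω.2 a]
    ring
  · exact fun x _ => B.measurableSet_atom _ _
  · intro x _ z _ hxz
    refine Set.disjoint_left.2 fun w hw hw' => hxz ?_
    exact (Fin.snoc_inj.1 (Eq.trans (Eq.symm hw) hw')).2
  · exact fun x _ => (B.integrable_history hε hP hprior (t + 1) G).integrableOn

include hp

lemma condExp_beliefAt_succ {t : ℕ} (φ : (Fin K → ℝ) → ℝ) {ω : Ω}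
    (hω : B.Feasible t (history B.A B.R t ω)) :
    (μ[fun ω => φ (B.beliefAt (t + 1) ω) | B.hist t]) ω =
      ∑ a, B.beliefAt t ω a * predict p ε (B.beliefAt t ω) a fun y =>
        φ (bayesUpdate p ε (B.beliefAt t ω) a y) := by
  have h := B.condExp_history_succ hε hP hprior hTS (fun h => φ (B.belief (t + 1) h)) hω
  refine h.trans (Finset.sum_congr rfl fun a _ => ?_)
  congr 1
  refine Finset.sum_congr rfl fun y hy => ?_
  simp only
  rw [B.belief_snoc hp hε hP hprior hTS hω a hy]
  rfl

lemma policyInfoGain_eq (t : ℕ) :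
    ∀ᵐ ω ∂μ, B.policyInfoGain negentropy t ω = beliefGain p ε (B.beliefAt t ω) := by
  have hgain : ∀ a, ∀ᵐ ω ∂μ, (μ[(B.A t ⁻¹' {a}).indicator
      (fun ω' => bregman negentropy (B.posterior (t + 1) ω') (B.posterior t ω')) | B.hist t]) ω =
      B.beliefAt t ω a * predict p ε (B.beliefAt t ω) a fun y =>
        bregman negentropy (bayesUpdate p ε (B.beliefAt t ω) a y) (B.beliefAt t ω) := by
    intro a
    -- The indicator and both posteriors are functions of the longer history, `Fin.init` recovering
    -- the earlier one, so the one-step predictive law applies.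
    let G : (Fin (t + 1) → Fin K × I) → ℝ := fun h => if (h (Fin.last t)).1 = a then
      bregman negentropy (B.belief (t + 1) h) (B.belief t (Fin.init h)) else 0
    have hae : ((B.A t ⁻¹' {a}).indicator
        (fun ω' => bregman negentropy (B.posterior (t + 1) ω') (B.posterior t ω'))) =ᵐ[μ]
        fun ω => G (history B.A B.R (t + 1) ω) := by
      filter_upwards [B.ae_feasible hε hP hprior t, B.ae_feasible hε hP hprior (t + 1)]
        with ω h1 h2
      simp only [Set.indicator, Set.mem_preimage, Set.mem_singleton_iff,
        B.posterior_eq_beliefAt h1, B.posterior_eq_beliefAt h2]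
      rfl
    filter_upwards [condExp_congr_ae (m := B.hist t) hae, B.ae_feasible hε hP hprior t]
      with ω h1 hω
    refine h1.trans ((B.condExp_history_succ hε hP hprior hTS G hω).trans ?_)
    rw [Finset.sum_eq_single a]
    · congr 1
      refine Finset.sum_congr rfl fun y hy => ?_
      simp only [G, Fin.snoc_last, Fin.init_snoc, if_true]
      rw [B.belief_snoc hp hε hP hprior hTS hω a hy]
      rfl
    · intro b _ hb
      simp [G, predict, hb]
    · simp
  filter_upwards [ae_all_iff.2 hgain, ae_all_iff.2 (hTS t), B.ae_feasible hε hP hprior t]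
    with ω h1 h2 hω
  refine Finset.sum_congr rfl fun a _ => ?_
  have hpos := B.beliefAt_pos hp hε hP hprior hω a
  rw [infoGain, h1, h2, B.posterior_eq_beliefAt hω, mul_div_cancel_left₀ _ hpos.ne']

omit hp

lemma policyRegret_eq (t : ℕ) :
    ∀ᵐ ω ∂μ, B.policyRegret t ω = ε * (1 - ∑ i, B.beliefAt t ω i ^ 2) := by
  filter_upwards [ae_all_iff.2 fun a => B.expRegret_eq hε hP hprior (t := t) a,
    ae_all_iff.2 (hTS t), B.ae_feasible hε hP hprior t] with ω h1 h2 hω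
  rw [← sum_mul_one_sub (B.sum_beliefAt hω), Finset.mul_sum]
  refine Finset.sum_congr rfl fun a _ => ?_
  rw [h1, h2, B.posterior_eq_beliefAt hω]
  ring

include hp

lemma infoRatio_le (hK : 2 ≤ K) (t : ℕ) : ∀ᵐ ω ∂μ, 0 < B.policyInfoGain negentropy t ω ∧
    B.infoRatio negentropy t ω ≤
      (1 + B.maxPosterior t ω) ^ 2 / (2 * B.maxPosterior t ω ^ 2) := by
  filter_upwards [B.policyInfoGain_eq hp hε hP hprior hTS t, B.policyRegret_eq hε hP hprior hTS t,
    B.ae_feasible hε hP hprior t] with ω h1 h2 hω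
  rw [infoRatio, maxPosterior, h1, h2]
  simp only [B.posterior_eq_beliefAt hω]
  exact belief_infoRatio_le hK hp hε (B.beliefAt_pos hp hε hP hprior hω)
    (B.sum_beliefAt hω)

/-! ### Regret bound and concentration of the posterior. -/

omit hp

/-- The expected regret of Thompson sampling at time `t`. -/
lemma integral_regret_step (t : ℕ) :
    ∫ ω, (B.RStar ω - (B.R (t + 1) ω (B.A t ω) : ℝ)) ∂μ =
      ∫ ω, ε * (1 - ∑ i, B.beliefAt t ω i ^ 2) ∂μ := by
  have hae : (fun ω => B.RStar ω - (B.R (t + 1) ω (B.A t ω) : ℝ)) =ᵐ[μ] fun ω =>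
      (fun h : Fin (t + 1) → Fin K × I => p + ε - ((h (Fin.last t)).2 : ℝ))
        (history B.A B.R (t + 1) ω) := by
    filter_upwards [B.ae_RStar_eq hε hP hprior] with ω hω
    rw [hω]
    rfl
  rw [integral_congr_ae hae, ← integral_condExp (B.measurable_hist t).comap_le]
  refine integral_congr_ae ?_
  filter_upwards [B.ae_feasible hε hP hprior t] with ω hω
  have hsum := B.sum_beliefAt hω
  refine (B.condExp_history_succ hε hP hprior hTS (fun h => p + ε - ((h (Fin.last t)).2 : ℝ))
    hω).trans ?_
  rw [← sum_mul_one_sub hsum, Finset.mul_sum]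
  refine Finset.sum_congr rfl fun a _ => ?_
  simp only [predict_eq, Fin.snoc_last, mixLik_zero hsum, mixLik_one hsum, Set.Icc.coe_zero,
    Set.Icc.coe_one]
  ring

include hp

lemma regret_step_succ_le (t : ℕ) :
    ∫ ω, ε * (1 - ∑ i, B.beliefAt (t + 1) ω i ^ 2) ∂μ ≤
      ∫ ω, ε * (1 - ∑ i, B.beliefAt t ω i ^ 2) ∂μ := by
  have hle : ∫ ω, ∑ i, B.beliefAt t ω i ^ 2 ∂μ ≤ ∫ ω, ∑ i, B.beliefAt (t + 1) ω i ^ 2 ∂μ := by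
    rw [← integral_condExp (B.measurable_hist t).comap_le
      (f := fun ω => ∑ i, B.beliefAt (t + 1) ω i ^ 2)]
    refine integral_mono_ae (B.integrable_beliefAt hε hP hprior t fun u => ∑ i, u i ^ 2)
      integrable_condExp ?_
    filter_upwards [B.ae_feasible hε hP hprior t] with ω hω
    rw [B.condExp_beliefAt_succ hp hε hP hprior hTS (fun u => ∑ i, u i ^ 2) hω]
    exact sum_sq_le_predict hp hε (B.beliefAt_pos hp hε hP hprior hω)
      (B.sum_beliefAt hω)
  simp only [integral_const_mul]
  rw [integral_sub (integrable_const _)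
    (B.integrable_beliefAt hε hP hprior (t + 1) fun u => ∑ i, u i ^ 2),
    integral_sub (integrable_const _)
    (B.integrable_beliefAt hε hP hprior t fun u => ∑ i, u i ^ 2)]
  exact mul_le_mul_of_nonneg_left (sub_le_sub_left hle _) hε.1.le

lemma sq_regret_step_le (t : ℕ) :
    (∫ ω, ε * (1 - ∑ i, B.beliefAt t ω i ^ 2) ∂μ) ^ 2 ≤
      √K * (∫ ω, ∑ i, 2 * √(B.beliefAt t ω i) ∂μ -
        ∫ ω, ∑ i, 2 * √(B.beliefAt (t + 1) ω i) ∂μ) := by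
  have hsq : (∫ ω, ε * (1 - ∑ i, B.beliefAt t ω i ^ 2) ∂μ) ^ 2 ≤
      ∫ ω, (ε * (1 - ∑ i, B.beliefAt t ω i ^ 2)) ^ 2 ∂μ := by
    set r := ∫ ω, ε * (1 - ∑ i, B.beliefAt t ω i ^ 2) ∂μ with hr
    -- Jensen for the square, by integrating the tangent bound `x² ≥ 2 r x - r²` at the mean `r`.
    have h1 : ∫ ω, (2 * r * (ε * (1 - ∑ i, B.beliefAt t ω i ^ 2)) - r ^ 2) ∂μ ≤
        ∫ ω, (ε * (1 - ∑ i, B.beliefAt t ω i ^ 2)) ^ 2 ∂μ := by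
      refine integral_mono (B.integrable_beliefAt hε hP hprior t
        fun u => 2 * r * (ε * (1 - ∑ i, u i ^ 2)) - r ^ 2) (B.integrable_beliefAt hε hP hprior t
        fun u => (ε * (1 - ∑ i, u i ^ 2)) ^ 2) fun ω => ?_
      simp only
      linarith [sq_nonneg (ε * (1 - ∑ i, B.beliefAt t ω i ^ 2) - r)]
    rw [integral_sub (B.integrable_beliefAt hε hP hprior t
      fun u => 2 * r * (ε * (1 - ∑ i, u i ^ 2))) (integrable_const _), integral_const_mul,
      ← hr] at h1
    simp only [integral_const, probReal_univ, one_smul] at h1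
    linarith
  have hint := B.integrable_beliefAt hε hP hprior t fun u => ∑ i, 2 * √(u i)
  refine hsq.trans ?_
  rw [← integral_condExp (B.measurable_hist t).comap_le
    (f := fun ω => ∑ i, 2 * √(B.beliefAt (t + 1) ω i)), ← integral_sub hint integrable_condExp,
    ← integral_const_mul]
  refine integral_mono_ae (B.integrable_beliefAt hε hP hprior t
    fun u => (ε * (1 - ∑ i, u i ^ 2)) ^ 2) ((hint.sub integrable_condExp).const_mul _) ?_
  filter_upwards [B.ae_feasible hε hP hprior t] with ω hω
  rw [B.condExp_beliefAt_succ hp hε hP hprior hTS (fun u => ∑ i, 2 * √(u i)) hω]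
  exact sq_regret_le_sqrt hp hε (B.beliefAt_pos hp hε hP hprior hω)
    (B.sum_beliefAt hω)

/-- The regret bound obtained from the potential `-2 ∑ √uᵢ`. -/
lemma sum_regret_step_le (T : ℕ) :
    ∑ t ∈ Finset.range T, ∫ ω, ε * (1 - ∑ i, B.beliefAt t ω i ^ 2) ∂μ ≤ √(2 * K * T) := by
  refine Real.le_sqrt_of_sq_le ?_
  have h0 : ∫ ω, ∑ i, 2 * √(B.beliefAt 0 ω i) ∂μ ≤ 2 * √K := by
    calc _ ≤ ∫ _, 2 * √(K : ℝ) ∂μ := by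
          refine integral_mono_ae (B.integrable_beliefAt hε hP hprior 0
            fun u => ∑ i, 2 * √(u i)) (integrable_const _) ?_
          filter_upwards [B.ae_feasible hε hP hprior 0] with ω hω
          rw [← Finset.mul_sum]
          exact mul_le_mul_of_nonneg_left (sum_sqrt_le (B.beliefAt_pos hp hε hP hprior hω)
            (B.sum_beliefAt hω)) zero_le_two
      _ = 2 * √K := by simp
  have hT : 0 ≤ ∫ ω, ∑ i, 2 * √(B.beliefAt T ω i) ∂μ :=
    integral_nonneg fun ω => Finset.sum_nonneg fun i _ => by positivity
  -- The drops of the expected potential telescope; the final potential is nonnegative and the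
  -- initial one at most `2 √K`.
  have h1 : ∑ t ∈ Finset.range T, (∫ ω, ε * (1 - ∑ i, B.beliefAt t ω i ^ 2) ∂μ) ^ 2 ≤ 2 * K := by
    calc _ ≤ ∑ t ∈ Finset.range T, √K * (∫ ω, ∑ i, 2 * √(B.beliefAt t ω i) ∂μ -
          ∫ ω, ∑ i, 2 * √(B.beliefAt (t + 1) ω i) ∂μ) :=
        Finset.sum_le_sum fun t _ => B.sq_regret_step_le hp hε hP hprior hTS t
      _ = √K * (∫ ω, ∑ i, 2 * √(B.beliefAt 0 ω i) ∂μ -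
          ∫ ω, ∑ i, 2 * √(B.beliefAt T ω i) ∂μ) := by
        rw [← Finset.mul_sum, Finset.sum_range_sub']
      _ ≤ √K * (2 * √K) := by
        gcongr
        linarith
      _ = 2 * K := by
        rw [mul_left_comm, Real.mul_self_sqrt (Nat.cast_nonneg K)]
  have h2 := sq_sum_le_card_mul_sum_sq (s := Finset.range T)
    (f := fun t => ∫ ω, ε * (1 - ∑ i, B.beliefAt t ω i ^ 2) ∂μ)
  rw [Finset.card_range] at h2
  calc _ ≤ _ := h2
    _ ≤ T * (2 * K) := by gcongr
    _ = 2 * K * T := by ring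

theorem regret_le_sqrt (T : ℕ) : B.regret T ≤ √(2 * K * T) := by
  rw [regret, integral_finsetSum _ fun t _ => B.integrable_regret_step hε hP hprior t]
  simp only [B.integral_regret_step hε hP hprior hTS]
  exact B.sum_regret_step_le hp hε hP hprior hTS T

/-- A decreasing sequence has its `t`-th term at most the average of the preceding `t` terms. The
factor 2 is the one that Markov's inequality at level `ε/2` produces. -/
lemma regret_step_le {t : ℕ} (ht : 1 ≤ t) :
    2 * ∫ ω, ε * (1 - ∑ i, B.beliefAt t ω i ^ 2) ∂μ ≤ √(8 * K / t) := by
  have hanti : Antitone fun s => ∫ ω, ε * (1 - ∑ i, B.beliefAt s ω i ^ 2) ∂μ :=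
    antitone_nat_of_succ_le fun s => B.regret_step_succ_le hp hε hP hprior hTS s
  have ht0 : (0 : ℝ) < t := by exact_mod_cast ht
  have h1 : t * ∫ ω, ε * (1 - ∑ i, B.beliefAt t ω i ^ 2) ∂μ ≤ √(2 * K * t) := by
    refine le_trans ?_ (B.sum_regret_step_le hp hε hP hprior hTS t)
    rw [← nsmul_eq_mul, ← Finset.card_range t, ← Finset.sum_const, Finset.card_range]
    exact Finset.sum_le_sum fun s hs => hanti (Finset.mem_range.1 hs).le
  have h2 : √(8 * K / t) = 2 * (√(2 * K * t) / t) := by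
    rw [show (8 : ℝ) * K / t = 2 * K * t * (2 / t) ^ 2 by field_simp; ring,
      Real.sqrt_mul (by positivity), Real.sqrt_sq (by positivity)]
    ring
  rw [h2]
  refine mul_le_mul_of_nonneg_left ?_ zero_le_two
  rwa [le_div_iff₀' ht0]

lemma le_real_maxPosterior {t : ℕ} (ht : 1 ≤ t) :
    1 - 1 / ε * √(8 * K / t) ≤ μ.real {ω | 1 / 2 < B.maxPosterior t ω} := by
  have hε0 := hε.1
  have hint := B.integrable_beliefAt hε hP hprior t fun u => ε * (1 - ∑ i, u i ^ 2)
  have hsub : ∀ᵐ ω ∂μ, ω ∈ {ω | 1 / 2 < B.maxPosterior t ω}ᶜ →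
      ω ∈ {ω | ε / 2 ≤ ε * (1 - ∑ i, B.beliefAt t ω i ^ 2)} := by
    filter_upwards [B.ae_feasible hε hP hprior t] with ω hω hq
    have hq' : ⨆ a, B.posterior t ω a ≤ 1 / 2 := not_lt.1 hq
    have hpos := B.beliefAt_pos hp hε hP hprior hω
    have hsum := B.sum_beliefAt hω
    simp only [B.posterior_eq_beliefAt hω] at hq'
    have hle : ∀ i, B.beliefAt t ω i ≤ 1 / 2 := fun i =>
      (le_ciSup (Set.finite_range _).bddAbove i).trans hq'
    -- If no belief exceeds 1/2, then `∑ α_i² ≤ 1/2`, which makes the step regret at least `ε/2`.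
    have h2 : ∑ i, B.beliefAt t ω i ^ 2 ≤ ∑ i, B.beliefAt t ω i * (1 / 2) :=
      Finset.sum_le_sum fun i _ => by
        rw [sq]
        exact mul_le_mul_of_nonneg_left (hle i) (hpos i).le
    rw [← Finset.sum_mul, hsum] at h2
    change ε / 2 ≤ _
    nlinarith
  have hnonneg : 0 ≤ᵐ[μ] fun ω => ε * (1 - ∑ i, B.beliefAt t ω i ^ 2) := by
    filter_upwards [B.ae_feasible hε hP hprior t] with ω hω
    have hpos := B.beliefAt_pos hp hε hP hprior hω
    have hsum := B.sum_beliefAt hω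
    rw [← sum_mul_one_sub hsum]
    refine mul_nonneg hε0.le (Finset.sum_nonneg fun i _ => mul_nonneg (hpos i).le ?_)
    rw [sub_nonneg, ← hsum]
    exact Finset.single_le_sum (fun j _ => (hpos j).le) (Finset.mem_univ i)
  have hmarkov := mul_meas_ge_le_integral_of_nonneg hnonneg hint (ε / 2)
  have hstep := B.regret_step_le hp hε hP hprior hTS ht
  have hcompl : μ.real {ω | 1 / 2 < B.maxPosterior t ω}ᶜ ≤
      μ.real {ω | ε / 2 ≤ ε * (1 - ∑ i, B.beliefAt t ω i ^ 2)} :=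
    ENNReal.toReal_mono (measure_ne_top _ _) (measure_mono_ae hsub)
  -- Subadditivity is enough here and needs no measurability of the event.
  have hone : 1 ≤ μ.real {ω | 1 / 2 < B.maxPosterior t ω} +
      μ.real {ω | 1 / 2 < B.maxPosterior t ω}ᶜ := by
    have h := measureReal_union_le (μ := μ) {ω | 1 / 2 < B.maxPosterior t ω}
      {ω | 1 / 2 < B.maxPosterior t ω}ᶜ
    rwa [Set.union_compl_self, probReal_univ] at h
  have hfin : μ.real {ω | ε / 2 ≤ ε * (1 - ∑ i, B.beliefAt t ω i ^ 2)} ≤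
      1 / ε * √(8 * K / t) := by
    rw [one_div, ← div_eq_inv_mul, le_div_iff₀' hε0]
    linarith
  linarith

end Hard

end BayesianBandit

end

theorem proposition2 {Ω : Type*} [MeasurableSpace Ω] (μ : Measure Ω) [IsProbabilityMeasure μ]
    {K : ℕ} (hK : 2 ≤ K) {p ε : ℝ} (hp : p ∈ Set.Ioo (0 : ℝ) 1) (hε : ε ∈ Set.Ioo 0 (1 - p))
    (P : Fin K → RewardLaw K) (hP : HasHardMarginals p ε P)
    (B : BayesianBandit K μ) (hprior : μ.map B.pStar = uniformPrior P)
    (hTS : B.IsThompsonSampling) :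
    (∀ t : ℕ, 1 ≤ t →
      1 - 1 / ε * Real.sqrt (8 * K / t) ≤ μ.real {ω | 1 / 2 < B.maxPosterior t ω}) ∧
    (∀ t : ℕ, ∀ᵐ ω ∂μ, 0 < B.policyInfoGain negentropy t ω ∧
      B.infoRatio negentropy t ω ≤
        (1 + B.maxPosterior t ω) ^ 2 / (2 * B.maxPosterior t ω ^ 2)) ∧
    (∀ t : ℕ, 1 ≤ t →
      1 - 1 / ε * Real.sqrt (8 * K / t) ≤ μ.real {ω | B.infoRatio negentropy t ω ≤ 8}) ∧
    (∀ T : ℕ, B.regret T ≤ 6 * Real.sqrt (2 * K * T)) := by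
  have hratio := fun t => B.infoRatio_le hp hε hP hprior hTS hK t
  refine ⟨fun t ht => B.le_real_maxPosterior hp hε hP hprior hTS ht, hratio, fun t ht => ?_,
    fun T => ?_⟩
  · refine (B.le_real_maxPosterior hp hε hP hprior hTS ht).trans
      (ENNReal.toReal_mono (measure_ne_top _ _) (measure_mono_ae ?_))
    filter_upwards [hratio t] with ω h1 hq
    have hq' : 1 / 2 < B.maxPosterior t ω := hq
    refine h1.2.trans ?_
    -- For `q > 1/2` the bound `(1 + q)² / (2 q²)` is below 9/2, so 8 leaves room.
    rw [div_le_iff₀ (by positivity)]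
    nlinarith
  · have := B.regret_le_sqrt hp hε hP hprior hTS T
    linarith [Real.sqrt_nonneg (2 * K * T : ℝ)]
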